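/- **Setting.** Let $P,Q$ be probability measures on a measurable space $\mathcal X$ and let $f:(0,\infty)\to\mathbb R$ be convex with $f(1)=0$. Put $f(0):=\lim_{t\downarrow0}f(t)$ and $f'(\infty):=\lim_{t\to\infty}f(t)/t$, both in $(-\infty,\infty]$. The $f$-divergence is $\mathbb I_f(P,Q):=\int f\!\left(\frac{dP}{dQ}\right)dQ+f'(\infty)\,P^{s}(\mathcal X)$, where $P^s$ is the part of $P$ singular to $Q$ and $\frac{dP}{dQ}$ is the density of the rest, with $\infty\cdot 0=0$ (so $\mathbb I_f(P,Q)=\int f(dP/dQ)\,dQ$ if $P\ll Q$). For $\pi\in[0,1]$ let $V_\pi(P,Q):=\mathbb I_{f_\pi}(P,Q)$ with $f_\pi(t):=\min\{\pi,1-\pi\}-\min\{1-\pi,\pi t\}$. Let $\gamma_f(\pi)\,d\pi=\pi^{-3}f''\!\left(\frac{1-\pi}{\pi}\right)d\pi$ on $(0,1)$; for general $f$ this is the measure obtained from $(1+t)\,df'_+(t)$ on $(0,\infty)$ by the map $t\mapsto\pi=1/(1+t)$, $f'_+$ being the right derivative. Integrals $\int_u^v\cdot\,\gamma_f$ are over $(u,v]$.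 Let $\Gamma_f(\pi)=\int^\pi\gamma_f(t)\,dt$ and $\bar\Gamma_f(\pi)=\int^\pi\Gamma_f(t)\,dt$ on $(0,1)$, with arbitrary constants of integration. **Theorem 2.** Let $n\ge1$, $0<\pi_1<\dots<\pi_n<1$, $\pi_0:=0$, $\pi_{n+1}:=1$, and for $i=0,\dots,n+1$ let $\psi_i:=(1-\pi_i)\wedge\pi_i-V_{\pi_i}(P,Q)$ (so $\psi_0=\psi_{n+1}=0$). Let $$A_n:=\Big\{\mathbf a\in\mathbb R^n:\ \tfrac{\psi_{i+1}-\psi_i}{\pi_{i+1}-\pi_i}\le a_i\le\tfrac{\psi_i-\psi_{i-1}}{\pi_i-\pi_{i-1}},\ i=1,\dots,n\Big\}.$$ For $\mathbf a\in A_n$ put $a_0:=1$, $a_{n+1}:=-1$ and, for $i=0,\dots,n$, $$\tilde\pi_i:=\frac{\psi_i-\psi_{i+1}+a_{i+1}\pi_{i+1}-a_i\pi_i}{a_{i+1}-a_i}\quad(\tilde\pi_i:=\pi_i\text{ if }a_{i+1}=a_i).$$ Let $j$ be the least $k\in\{1,\dots,n\}$ with $\tfrac12\le\tilde\pi_k$.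 For $i=0,\dots,n+1$ let $\bar\pi_i:=\tilde\pi_i$ if $i<j$, $\bar\pi_j:=\tfrac12$, and $\bar\pi_i:=\tilde\pi_{i-1}$ if $i>j$. For $i=1,\dots,n+1$ let $$\alpha_{\mathbf a,i}:=\begin{cases}1-a_i,&i\le j\\-1-a_{i-1},&i>j\end{cases}\qquad \beta_{\mathbf a,i}:=\begin{cases}a_i\pi_i-\psi_i,&i\le j\\1-\psi_{i-1}+a_{i-1}\pi_{i-1},&i>j.\end{cases}$$ Then $$\mathbb I_f(P,Q)\ \ge\ \min_{\mathbf a\in A_n}\sum_{i=0}^n\int_{\bar\pi_i}^{\bar\pi_{i+1}}(\alpha_{\mathbf a,i+1}\pi+\beta_{\mathbf a,i+1})\,\gamma_f(\pi)\,d\pi$$ $$=\min_{\mathbf a\in A_n}\sum_{i=0}^n\Big[(\alpha_{\mathbf a,i+1}\bar\pi_{i+1}+\beta_{\mathbf a,i+1})\Gamma_f(\bar\pi_{i+1})-\alpha_{\mathbf a,i+1}\bar\Gamma_f(\bar\pi_{i+1})-(\alpha_{\mathbf a,i+1}\bar\pi_i+\beta_{\mathbf a,i+1})\Gamma_f(\bar\pi_i)+\alpha_{\mathbf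 a,i+1}\bar\Gamma_f(\bar\pi_i)\Big],$$ where both minima are attained in $[0,\infty]$, the two objectives agree for every $\mathbf a\in A_n$, and the terms at $\bar\pi_0=0$ or $\bar\pi_{n+1}=1$ are read as one-sided limits in $[-\infty,\infty]$. If in addition $\mathcal X$ is a topological space whose points are closed, whose open sets are measurable, and which has a connected component with more than one point, then the bound is tight: there are probability measures $P',Q'$ on $\mathcal X$ with $V_{\pi_i}(P',Q')=V_{\pi_i}(P,Q)$ for $i=1,\dots,n$ and $\mathbb I_f(P',Q')$ equal to the minimum. -/

import Mathlib

open MeasureTheory Set Filter Topology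

namespace GenPinsker

noncomputable section

/-! ### Extended-real integrals and `f`-divergences -/

/-- The extended-real integral `∫ g dμ = ∫ g⁺ dμ - ∫ g⁻ dμ`. -/
def eintegral {α : Type*} [MeasurableSpace α] (μ : Measure α) (g : α → ℝ) : EReal :=
  ((∫⁻ x, ENNReal.ofReal (g x) ∂μ : ENNReal) : EReal)
    - ((∫⁻ x, ENNReal.ofReal (-g x) ∂μ : ENNReal) : EReal)

/-- `f(0+) = lim_{t ↓ 0} f(t)` in `(-∞, ∞]` (the limit exists for convex `f`). -/
def limZero (f : ℝ → ℝ) : EReal := limsup (fun t : ℝ => ((f t : ℝ) : EReal)) (𝓝[>] 0)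

/-- `f'(∞) = lim_{t → ∞} f(t) / t` in `(-∞, ∞]` (the limit exists for convex `f`). -/
def slopeTop (f : ℝ → ℝ) : EReal := limsup (fun t : ℝ => ((f t / t : ℝ) : EReal)) atTop

/-- The `f`-divergence `I_f(P, Q)` of two probability measures, for a function `f` that matters
only on `(0, ∞)`. For `P ≪ Q` this is `∫ f(dP/dQ) dQ`, where `f(0)` is read as `f(0+)`.
Without absolute continuity the part of `P` that is singular to `Q` contributes `f'(∞)` times
its mass. -/
def fDiv {X : Type*} [MeasurableSpace X] (f : ℝ → ℝ) (P Q : Measure X) : EReal :=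
  eintegral (Q.restrict {x | P.rnDeriv Q x ≠ 0}) (fun x => f (P.rnDeriv Q x).toReal)
    + limZero f * ((Q {x | P.rnDeriv Q x = 0} : ENNReal) : EReal)
    + slopeTop f * ((P.singularPart Q univ : ENNReal) : EReal)

/-- The primitive function `f_π(t) = min {π, 1 - π} - min {1 - π, π t}`. -/
def fPrim (π t : ℝ) : ℝ := min π (1 - π) - min (1 - π) (π * t)

/-- The generalised variational divergence `V_π(P, Q) = I_{f_π}(P, Q)` (a finite number). -/
def genVar {X : Type*} [MeasurableSpace X] (π : ℝ) (P Q : Measure X) : ℝ :=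
  (fDiv (fPrim π) P Q).toReal

/-! ### The weight `γ_f` -/

instance instCompactIccSpaceIoi : CompactIccSpace (Ioi (0 : ℝ)) where
  isCompact_Icc := by
    intro a b
    rw [Subtype.isCompact_iff]
    have h : (Subtype.val '' Icc a b : Set ℝ) = Icc (a : ℝ) b := by
      ext x
      constructor
      · rintro ⟨y, hy, rfl⟩
        exact hy
      · intro hx
        exact ⟨⟨x, lt_of_lt_of_le a.2 hx.1⟩, hx, rfl⟩
    rw [h]
    exact isCompact_Icc

/-- The right-hand derivative of a convex function on `(0, ∞)` is monotone. -/
theorem rightDeriv_mono {f : ℝ → ℝ} (hf : ConvexOn ℝ (Ioi 0) f) :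
    Monotone (fun t : Ioi (0 : ℝ) => derivWithin f (Ioi (t : ℝ)) t) := by
  intro s t hst
  have h := hf.monotoneOn_rightDeriv
  rw [interior_Ioi] at h
  exact h s.2 t.2 hst

/-- The Lebesgue-Stieltjes measure `df'_+` on `(0, ∞)` of a convex function `f`: it gives mass
`f'_+(t) - f'_+(s)` to `(s, t]`, and has density `f''` if `f` is twice continuously
differentiable. -/
def curvature {f : ℝ → ℝ} (hf : ConvexOn ℝ (Ioi 0) f) : Measure (Ioi (0 : ℝ)) :=
  (rightDeriv_mono hf).stieltjesFunction.measure

/-- The weight `γ_f(π) = f''((1 - π) / π) / π ^ 3` as a measure `γ_f(π) dπ` on `(0, 1)`. It is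
the measure `(1 + t) df'_+(t)`, transported by `t ↦ π = 1 / (1 + t)`, i.e. `t = (1 - π) / π`:
where `f''` exists, `(1 + t) f''(t) dt = π⁻¹ f''((1 - π) / π) π⁻² dπ`. -/
def weight {f : ℝ → ℝ} (hf : ConvexOn ℝ (Ioi 0) f) : Measure ℝ :=
  ((curvature hf).withDensity (fun t => ENNReal.ofReal (1 + (t : ℝ)))).map
    (fun t : Ioi (0 : ℝ) => 1 / (1 + (t : ℝ)))

/-- `G` and `Gbar` are a first and a second integral of the measure `γ` on `(0, 1)`:
`G(π) = ∫^π dγ` and `Gbar(π) = ∫^π G(t) dt`, with arbitrary constants of integration. -/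
structure IsIteratedPrimitive (γ : Measure ℝ) (G Gbar : ℝ → ℝ) : Prop where
  sub_eq : ∀ u v : ℝ, 0 < u → u ≤ v → v < 1 → G v - G u = (γ (Ioc u v)).toReal
  bar_sub_eq : ∀ u v : ℝ, 0 < u → u ≤ v → v < 1 → Gbar v - Gbar u = ∫ t in u..v, G t

/-! ### The piecewise affine objective -/

/-- The family `l, v_1, …, v_n, r, r, …` with indices `0, 1, …, n, n + 1, …`. -/
def pad {n : ℕ} (l r : ℝ) (v : Fin n → ℝ) (i : ℕ) : ℝ :=
  if i = 0 then l else if h : i - 1 < n then v ⟨i - 1, h⟩ else r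

/-- The nodes `π_0 = 0 < π_1 < … < π_n < π_{n+1} = 1`. -/
def node {n : ℕ} (p : Fin n → ℝ) : ℕ → ℝ := pad 0 1 p

/-- The slopes `a_0 = 1, a_1, …, a_n, a_{n+1} = -1`. -/
def slp {n : ℕ} (a : Fin n → ℝ) : ℕ → ℝ := pad 1 (-1) a

/-- `ψ_i = (1 - π_i) ∧ π_i - V_{π_i}(P, Q)`. -/
def psi {X : Type*} [MeasurableSpace X] (P Q : Measure X) {n : ℕ} (p : Fin n → ℝ) (i : ℕ) : ℝ :=
  min (1 - node p i) (node p i) - genVar (node p i) P Q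

section Objective

variable {n : ℕ} (p : Fin n → ℝ) (ψ : ℕ → ℝ)

/-- The box `A_n` of admissible slopes. -/
def box : Set (Fin n → ℝ) :=
  {a | ∀ i ∈ Finset.Icc 1 n,
    (ψ (i + 1) - ψ i) / (node p (i + 1) - node p i) ≤ slp a i ∧
      slp a i ≤ (ψ i - ψ (i - 1)) / (node p i - node p (i - 1))}

variable (a : Fin n → ℝ)

/-- `π̃_i`, the abscissa where the lines of slopes `a_i`, `a_{i+1}` through `(π_i, ψ_i)` and
`(π_{i+1}, ψ_{i+1})` meet (`π_i` if the two slopes agree). -/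
def tildePi (i : ℕ) : ℝ :=
  if slp a (i + 1) = slp a i then node p i
  else (ψ i - ψ (i + 1) + slp a (i + 1) * node p (i + 1) - slp a i * node p i)
    / (slp a (i + 1) - slp a i)

/-- The index `j`, the first `k ∈ {1, …, n}` with `1 / 2 ≤ π̃_k`. -/
def jIdx : ℕ := sInf {k | 1 ≤ k ∧ k ≤ n ∧ 1 / 2 ≤ tildePi p ψ a k}

/-- The break points `π̃_0, …, π̃_{j-1}, 1/2, π̃_j, …, π̃_n`, numbered from `0` to `n + 1`. -/
def barPi (i : ℕ) : ℝ :=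
  if i < jIdx p ψ a then tildePi p ψ a i
  else if i = jIdx p ψ a then 1 / 2
  else tildePi p ψ a (i - 1)

/-- Slope of the objective on the `i`-th segment `[barPi (i - 1), barPi i]`, `1 ≤ i ≤ n + 1`. -/
def alphaCoef (i : ℕ) : ℝ :=
  if i ≤ jIdx p ψ a then 1 - slp a i else -1 - slp a (i - 1)

/-- Intercept of the objective on the `i`-th segment `[barPi (i - 1), barPi i]`,
`1 ≤ i ≤ n + 1`. -/
def betaCoef (i : ℕ) : ℝ :=
  if i ≤ jIdx p ψ a then slp a i * node p i - ψ i
  else 1 - ψ (i - 1) + slp a (i - 1) * node p (i - 1)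

/-- The objective as a sum of integrals of affine functions against `γ`. As `γ` may have atoms,
the segments are taken half open, so that no break point is counted twice. -/
def objective (γ : Measure ℝ) : EReal :=
  ∑ i ∈ Finset.range (n + 1),
    eintegral (γ.restrict (Ioc (barPi p ψ a i) (barPi p ψ a (i + 1))))
      (fun x => alphaCoef p ψ a (i + 1) * x + betaCoef p ψ a (i + 1))

/-- The value at `x` of `(α x + β) G(x) - α Gbar(x)`, read at the end points `0` and `1` of
`(0, 1)`, where `G` and `Gbar` may blow up, as the one-sided limit in `[-∞, ∞]`. -/
def boundaryTerm (G Gbar : ℝ → ℝ) (α β x : ℝ) : EReal :=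
  if x ∈ Ioo (0 : ℝ) 1 then (((α * x + β) * G x - α * Gbar x : ℝ) : EReal)
  else limUnder (𝓝[Ioo (0 : ℝ) 1] x)
    (fun t : ℝ => (((α * t + β) * G t - α * Gbar t : ℝ) : EReal))

/-- The objective in the integrated form. -/
def objectiveEval (G Gbar : ℝ → ℝ) : EReal :=
  ∑ i ∈ Finset.range (n + 1),
    (boundaryTerm G Gbar (alphaCoef p ψ a (i + 1)) (betaCoef p ψ a (i + 1)) (barPi p ψ a (i + 1))
      - boundaryTerm G Gbar (alphaCoef p ψ a (i + 1)) (betaCoef p ψ a (i + 1)) (barPi p ψ a i))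

end Objective

end

end GenPinsker

open GenPinsker

/-!
Write `L(π) = ∫ min {(1 - π) dQ, π dP}` for the Bayes risk of testing `P` against `Q` with prior
`π`, so that `V_π(P, Q) = min {π, 1 - π} - L(π)` (`genVar_eq`). A convex function is an affine
function plus a mixture of hinges with respect to its curvature (`lintegral_hinge`); integrating
this over the likelihood ratio gives the representation `I_f(P, Q) = ∫ V_π(P, Q) γ_f(dπ)`, for
arbitrary convex `f` and without absolute continuity (`fDiv_eq_lintegral`). The theorem thereby
becomes a statement about the concave function `L`.

For admissible slopes `a` let `U_a` be the concave piecewise affine function through the points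
`(π_i, ψ_i)` that has the slope `a_i` at `π_i` and the slopes `1` and `-1` at `0` and `1`
(`envelope`). Its kinks are the points `π̃_k`, with weights `a_k - a_{k+1}`, and the objective is
`∫ (min {π, 1 - π} - U_a(π)) γ_f(dπ)` (`objective_eq_lintegral`): the extra break point `1/2` is
where the minimum changes branch, and outside of `[π̃_0, π̃_n]` the integrand vanishes.

* Lower bound: supporting lines of `L` at the nodes have admissible slopes, and they force
  `L ≤ U_a` (`exists_mem_box_bayesRisk_le`).
* Attainment: `U_a(π)` is continuous in `a`, so by Fatou's lemma the objective is lower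
  semicontinuous on the compact box (`exists_min_gap`).
* Integrated form: integration by parts on each segment; the integrand is nonnegative there, so the
  antiderivative is monotone and has one-sided limits in the extended reals
  (`IsIteratedPrimitive.boundaryTerm_sub`).
* Tightness: `U_a` is itself the Bayes risk of two discrete measures with one atom for each kink
  (`exists_bayesRisk_eq_envelope`). A nontrivial connected component of a `T1` space is infinite,
  which provides the atoms.
-/

namespace GenPinsker

noncomputable section

/-! ### Convex functions as mixtures of hinges -/

/-- Integration by parts for a distribution function, by Tonelli's theorem: `x - u` is the length
of the set of `t` with `u < t < x`. -/
theorem lintegral_Ioc_sub_left (ν : Measure ℝ) [SFinite ν] (u v : ℝ) :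
    ∫⁻ x in Ioc u v, ENNReal.ofReal (x - u) ∂ν = ∫⁻ t in Ioc u v, ν (Ioc t v) := by
  set S : Set (ℝ × ℝ) := {q | u < q.2 ∧ q.2 < q.1} with hS
  have hSm : MeasurableSet S :=
    (measurableSet_lt measurable_const measurable_snd).inter
      (measurableSet_lt measurable_snd measurable_fst)
  have h1 : ∀ x : ℝ, ENNReal.ofReal (x - u) = ∫⁻ t, S.indicator 1 (x, t) := by
    intro x
    have : (fun t => S.indicator (1 : ℝ × ℝ → ENNReal) (x, t)) = (Ioo u x).indicator 1 := by
      ext t; simp [indicator, hS]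
    rw [this, lintegral_indicator_one measurableSet_Ioo, Real.volume_Ioo]
  simp_rw [h1]
  rw [lintegral_lintegral_swap (by exact (measurable_one.indicator hSm).aemeasurable),
    ← lintegral_indicator measurableSet_Ioc]
  congr 1
  ext t
  have : (fun x => S.indicator (1 : ℝ × ℝ → ENNReal) (x, t))
      = {x | u < t ∧ t < x}.indicator 1 := by
    ext x; simp [indicator, hS]
  rw [this, lintegral_indicator_one (by measurability), Measure.restrict_apply (by measurability)]
  by_cases ht : t ∈ Ioc u v
  · rw [indicator_of_mem ht]
    congr 1
    ext x
    simp only [mem_inter_iff, mem_ofPred_eq, mem_Ioc]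
    constructor
    · rintro ⟨⟨-, h⟩, -, h'⟩; exact ⟨h, h'⟩
    · rintro ⟨h, h'⟩; exact ⟨⟨ht.1, h⟩, ht.1.trans h, h'⟩
  · rw [indicator_of_notMem ht]
    convert measure_empty (μ := ν)
    ext x
    simp only [mem_inter_iff, mem_ofPred_eq, mem_Ioc, mem_empty_iff_false, iff_false]
    rintro ⟨⟨h1, h2⟩, -, h3⟩
    exact ht ⟨h1, h2.le.trans h3⟩

/-- The mirror image of `lintegral_Ioc_sub_left`: `v - x` is the length of the set of `t` with
`x ≤ t ≤ v`. -/
theorem lintegral_Ioc_sub_right (ν : Measure ℝ) [SFinite ν] (u v : ℝ) :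
    ∫⁻ x in Ioc u v, ENNReal.ofReal (v - x) ∂ν = ∫⁻ t in Ioc u v, ν (Ioc u t) := by
  set S : Set (ℝ × ℝ) := {q | q.1 ≤ q.2 ∧ q.2 ≤ v} with hS
  have hSm : MeasurableSet S :=
    (measurableSet_le measurable_fst measurable_snd).inter
      (measurableSet_le measurable_snd measurable_const)
  have h1 : ∀ x : ℝ, ENNReal.ofReal (v - x) = ∫⁻ t, S.indicator 1 (x, t) := by
    intro x
    have : (fun t => S.indicator (1 : ℝ × ℝ → ENNReal) (x, t)) = (Icc x v).indicator 1 := by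
      ext t; simp [indicator, hS]
    rw [this, lintegral_indicator_one measurableSet_Icc, Real.volume_Icc]
  simp_rw [h1]
  rw [lintegral_lintegral_swap (by exact (measurable_one.indicator hSm).aemeasurable),
    ← lintegral_indicator measurableSet_Ioc]
  congr 1
  ext t
  have : (fun x => S.indicator (1 : ℝ × ℝ → ENNReal) (x, t))
      = {x | x ≤ t ∧ t ≤ v}.indicator 1 := by
    ext x; simp [indicator, hS]
  rw [this, lintegral_indicator_one (by measurability), Measure.restrict_apply (by measurability)]
  by_cases ht : t ∈ Ioc u v
  · rw [indicator_of_mem ht]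
    congr 1
    ext x
    simp only [mem_inter_iff, mem_ofPred_eq, mem_Ioc]
    constructor
    · rintro ⟨⟨h, -⟩, h', -⟩; exact ⟨h', h⟩
    · rintro ⟨h, h'⟩; exact ⟨⟨h', ht.2⟩, h, h'.trans ht.2⟩
  · rw [indicator_of_notMem ht]
    convert measure_empty (μ := ν)
    ext x
    simp only [mem_inter_iff, mem_ofPred_eq, mem_Ioc, mem_empty_iff_false, iff_false]
    rintro ⟨⟨h1, h2⟩, h3, -⟩
    exact ht ⟨h3.trans_le h1, h2⟩

/-- The right derivative `f'_+(x)`. -/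
abbrev rderiv (f : ℝ → ℝ) (x : ℝ) : ℝ := derivWithin f (Ioi x) x

variable {f : ℝ → ℝ}

theorem rderiv_monotoneOn (hf : ConvexOn ℝ (Ioi 0) f) : MonotoneOn (rderiv f) (Ioi 0) := by
  have h := hf.monotoneOn_rightDeriv
  rwa [interior_Ioi] at h

/-- The right derivative of a convex function is right-continuous, so that passing to the
Stieltjes function does not change it. -/
theorem stieltjesFunction_rightDeriv (hf : ConvexOn ℝ (Ioi 0) f) (x : Ioi (0 : ℝ)) :
    (rightDeriv_mono hf).stieltjesFunction x = rderiv f x := by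
  rw [Monotone.stieltjesFunction_eq]
  refine le_antisymm ?_ ((rightDeriv_mono hf).le_rightLim le_rfl)
  have hx : (x : ℝ) ∈ interior (Ioi (0 : ℝ)) := by rw [interior_Ioi]; exact x.2
  rw [rderiv, hf.rightDeriv_eq_sInf_slope_of_mem_interior hx]
  refine le_csInf ⟨_, mem_image_of_mem _ (show (x : ℝ) + 1 ∈ _ from ⟨?_, by simp⟩)⟩ ?_
  · have := x.2; simp only [mem_Ioi] at this ⊢; linarith
  rintro _ ⟨z, ⟨hz0, hxz⟩, rfl⟩
  have hcont : ContinuousAt f x :=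
    (hf.continuousOn isOpen_Ioi).continuousAt (isOpen_Ioi.mem_nhds x.2)
  have hlim : Tendsto (fun y => slope f y z) (𝓝[>] (x : ℝ)) (𝓝 (slope f x z)) := by
    simp only [slope_def_field]
    refine Tendsto.mono_left ?_ nhdsWithin_le_nhds
    exact (tendsto_const_nhds.sub hcont).div (tendsto_const_nhds.sub tendsto_id)
      (sub_ne_zero.2 hxz.ne')
  refine ge_of_tendsto hlim ?_
  filter_upwards [Ioo_mem_nhdsGT hxz] with y hy
  have hy0 : y ∈ Ioi (0 : ℝ) := (show (0 : ℝ) < x from x.2).trans hy.1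
  refine le_trans ?_ (hf.rightDeriv_le_slope_of_mem_interior (by rwa [interior_Ioi]) hz0 hy.2)
  exact (rightDeriv_mono hf).rightLim_le (show x < (⟨y, hy0⟩ : Ioi (0 : ℝ)) from hy.1)

/-- The measure `df'_+`, regarded as a measure on the real line carried by `(0, ∞)`. -/
def lineCurvature (hf : ConvexOn ℝ (Ioi 0) f) : Measure ℝ := (curvature hf).map Subtype.val

instance (hf : ConvexOn ℝ (Ioi 0) f) : SigmaFinite (curvature hf) := by
  unfold curvature; infer_instance

instance (hf : ConvexOn ℝ (Ioi 0) f) : SFinite (lineCurvature hf) := by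
  unfold lineCurvature; infer_instance

instance (hf : ConvexOn ℝ (Ioi 0) f) : SFinite (weight hf) := by
  unfold weight; infer_instance

theorem lineCurvature_Ioc (hf : ConvexOn ℝ (Ioi 0) f) {a b : ℝ} (ha : 0 < a) (hab : a ≤ b) :
    lineCurvature hf (Ioc a b) = ENNReal.ofReal (rderiv f b - rderiv f a) := by
  have hb : 0 < b := ha.trans_le hab
  have : (Subtype.val ⁻¹' Ioc a b : Set (Ioi (0 : ℝ))) = Ioc ⟨a, ha⟩ ⟨b, hb⟩ := by
    ext x; rfl
  rw [lineCurvature, Measure.map_apply measurable_subtype_coe measurableSet_Ioc, this, curvature,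
    StieltjesFunction.measure_Ioc, stieltjesFunction_rightDeriv hf, stieltjesFunction_rightDeriv hf]

theorem ae_lineCurvature_pos (hf : ConvexOn ℝ (Ioi 0) f) : ∀ᵐ s ∂(lineCurvature hf), 0 < s := by
  rw [lineCurvature, ae_map_iff measurable_subtype_coe.aemeasurable measurableSet_Ioi]
  exact Eventually.of_forall fun x => x.2

theorem lintegral_weight (hf : ConvexOn ℝ (Ioi 0) f) {φ : ℝ → ENNReal} (hφ : Measurable φ) :
    ∫⁻ x, φ x ∂(weight hf)
      = ∫⁻ s, ENNReal.ofReal (1 + s) * φ (1 / (1 + s)) ∂(lineCurvature hf) := by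
  have hm : Measurable (fun t : Ioi (0 : ℝ) => 1 / (1 + (t : ℝ))) := by fun_prop
  rw [weight, lintegral_map hφ hm, lineCurvature,
    lintegral_map (by fun_prop) measurable_subtype_coe]
  exact lintegral_withDensity_eq_lintegral_mul _ (by fun_prop) (hφ.comp hm)

theorem ae_weight_mem_Ioo (hf : ConvexOn ℝ (Ioi 0) f) : ∀ᵐ x ∂(weight hf), x ∈ Ioo (0 : ℝ) 1 := by
  rw [weight]
  refine (ae_map_iff (by fun_prop) (measurableSet_Ioo (a := (0 : ℝ)) (b := 1))).2 ?_
  refine Eventually.of_forall fun x => ?_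
  have hx : (0 : ℝ) < x := x.2
  refine ⟨by positivity, ?_⟩
  rw [div_lt_one (by positivity)]
  linarith

theorem weight_Ioc_lt_top (hf : ConvexOn ℝ (Ioi 0) f) {u v : ℝ} (hu : 0 < u) (hv : v < 1) :
    weight hf (Ioc u v) < ⊤ := by
  rcases lt_or_ge v u with h | huv
  · simp [Ioc_eq_empty_of_le h.le]
  have hv0 : 0 < v := hu.trans_le huv
  rw [← lintegral_indicator_one measurableSet_Ioc,
    lintegral_weight hf (measurable_one.indicator measurableSet_Ioc)]
  calc _ ≤ ∫⁻ s in Ioc ((1 / v - 1) / 2) (1 / u - 1), ENNReal.ofReal (1 / u)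
        ∂(lineCurvature hf) := by
        rw [← lintegral_indicator measurableSet_Ioc]
        refine lintegral_mono_ae ?_
        filter_upwards [ae_lineCurvature_pos hf] with s hs
        by_cases h : 1 / (1 + s) ∈ Ioc u v
        · have h1 : 1 / v ≤ 1 + s := by
            rw [div_le_iff₀ hv0]
            have := h.2; rw [div_le_iff₀ (by positivity)] at this; linarith
          have h2 : 1 + s ≤ 1 / u := by
            rw [le_div_iff₀ hu]
            have := h.1; rw [lt_div_iff₀ (by positivity)] at this; linarith
          have h3 : 1 < 1 / v := by rwa [lt_div_iff₀ hv0, one_mul]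
          have h5 : s ∈ Ioc ((1 / v - 1) / 2) (1 / u - 1) := ⟨by linarith, by linarith⟩
          rw [indicator_of_mem h, indicator_of_mem h5]
          simpa using ENNReal.ofReal_le_ofReal h2
        · rw [indicator_of_notMem h]; simp
    _ < ⊤ := by
        rw [setLIntegral_const]
        have h3 : 1 < 1 / v := by rwa [lt_div_iff₀ hv0, one_mul]
        have h4 : 1 / v ≤ 1 / u := one_div_le_one_div_of_le hu huv
        rw [lineCurvature_Ioc hf (by linarith) (by linarith)]
        exact ENNReal.mul_lt_top ENNReal.ofReal_lt_top ENNReal.ofReal_lt_top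

theorem integral_rderiv (hf : ConvexOn ℝ (Ioi 0) f) {a b : ℝ} (ha : 0 < a) (hab : a ≤ b) :
    IntervalIntegrable (rderiv f) volume a b ∧ ∫ x in a..b, rderiv f x = f b - f a := by
  have hsub : Icc a b ⊆ Ioi 0 := fun x hx => ha.trans_le hx.1
  have hint : IntervalIntegrable (rderiv f) volume a b := by
    apply MonotoneOn.intervalIntegrable
    rw [uIcc_of_le hab]
    exact (rderiv_monotoneOn hf).mono hsub
  refine ⟨hint, intervalIntegral.integral_eq_sub_of_hasDeriv_right_of_le hab
    ((hf.continuousOn isOpen_Ioi).mono hsub) (fun x hx => ?_) hint⟩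
  exact hf.hasDerivWithinAt_rightDeriv_of_mem_interior
    (by rw [interior_Ioi]; exact hsub (Ioo_subset_Icc_self hx))

/-- The affine function of `t` whose positive part is the hinge with corner `s` that vanishes at
`t = 1`. An atom of the curvature at `s = 1` is counted to the left of `1`, in accordance with the
use of the right derivative at `1` in `lintegral_hinge`. -/
def hinge (s t : ℝ) : ℝ := if s ≤ 1 then s - t else t - s

theorem measurable_hinge : Measurable (Function.uncurry hinge) := by
  unfold Function.uncurry hinge
  exact Measurable.ite (measurableSet_le measurable_fst measurable_const) (by fun_prop)
    (by fun_prop)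

/-- Second-order Taylor formula at `1`: up to an affine function, a convex function is a mixture
of hinges with respect to its curvature. -/
theorem lintegral_hinge (hf : ConvexOn ℝ (Ioi 0) f) {t : ℝ} (ht : 0 < t) :
    ∫⁻ s, ENNReal.ofReal (hinge s t) ∂(lineCurvature hf)
      = ENNReal.ofReal (f t - f 1 - rderiv f 1 * (t - 1)) := by
  have hmono := rderiv_monotoneOn hf
  rcases le_total 1 t with h | h
  · have h1 : (fun s => ENNReal.ofReal (hinge s t))
        = (Ioc 1 t).indicator (fun s => ENNReal.ofReal (t - s)) := by
      ext s
      simp only [hinge, indicator, mem_Ioc]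
      split_ifs with h1 h2 h2 <;>
        first | rfl | (exfalso; grind) | exact ENNReal.ofReal_of_nonpos (by grind)
    obtain ⟨hi, he⟩ := integral_rderiv hf one_pos h
    rw [h1, lintegral_indicator measurableSet_Ioc, lintegral_Ioc_sub_right,
      setLIntegral_congr_fun measurableSet_Ioc
        (fun x hx => lineCurvature_Ioc hf one_pos (le_of_lt hx.1)),
      ← ofReal_integral_eq_lintegral_ofReal, ← intervalIntegral.integral_of_le h,
      intervalIntegral.integral_sub hi (by simp), he]
    · simp; ring_nf
    · exact ((intervalIntegrable_iff_integrableOn_Ioc_of_le h).1 hi).sub (by simp)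
    · filter_upwards [ae_restrict_mem measurableSet_Ioc] with x hx
      exact sub_nonneg.2 (hmono (mem_Ioi.2 one_pos) (one_pos.trans hx.1) hx.1.le)
  · have h1 : (fun s => ENNReal.ofReal (hinge s t))
        = (Ioc t 1).indicator (fun s => ENNReal.ofReal (s - t)) := by
      ext s
      simp only [hinge, indicator, mem_Ioc]
      split_ifs with h1 h2 h2 <;>
        first | rfl | (exfalso; grind) | exact ENNReal.ofReal_of_nonpos (by grind)
    obtain ⟨hi, he⟩ := integral_rderiv hf ht h
    rw [h1, lintegral_indicator measurableSet_Ioc, lintegral_Ioc_sub_left,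
      setLIntegral_congr_fun measurableSet_Ioc
        (fun x hx => lineCurvature_Ioc hf (ht.trans hx.1) hx.2),
      ← ofReal_integral_eq_lintegral_ofReal, ← intervalIntegral.integral_of_le h,
      intervalIntegral.integral_sub (by simp) hi, he]
    · simp; ring_nf
    · exact Integrable.sub (by simp) ((intervalIntegrable_iff_integrableOn_Ioc_of_le h).1 hi)
    · filter_upwards [ae_restrict_mem measurableSet_Ioc] with x hx
      exact sub_nonneg.2 (hmono (ht.trans hx.1) (mem_Ioi.2 one_pos) hx.2)

/-! ### Divergences as mixtures of primitive divergences -/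

section Eintegral

variable {α : Type*} [MeasurableSpace α] {μ : Measure α} {g k : α → ℝ}

theorem eintegral_of_integrable (hg : Integrable g μ) :
    eintegral μ g = ((∫ x, g x ∂μ : ℝ) : EReal) := by
  have h1 : ∫⁻ x, ENNReal.ofReal (g x) ∂μ ≠ ⊤ := hg.lintegral_lt_top.ne
  have h2 : ∫⁻ x, ENNReal.ofReal (-g x) ∂μ ≠ ⊤ := hg.neg.lintegral_lt_top.ne
  rw [eintegral, integral_eq_lintegral_pos_part_sub_lintegral_neg_part hg, EReal.coe_sub,
    EReal.coe_ennreal_toReal h1, EReal.coe_ennreal_toReal h2]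

theorem eintegral_of_nonneg (hg : 0 ≤ᵐ[μ] g) :
    eintegral μ g = ((∫⁻ x, ENNReal.ofReal (g x) ∂μ : ENNReal) : EReal) := by
  have : ∫⁻ x, ENNReal.ofReal (-g x) ∂μ = 0 := by
    rw [lintegral_congr_ae (g := fun _ => 0)]
    · simp
    · filter_upwards [hg] with x hx
      exact ENNReal.ofReal_of_nonpos (by simpa using hx)
  rw [eintegral, this]
  simp

theorem eintegral_congr (h : g =ᵐ[μ] k) : eintegral μ g = eintegral μ k := by
  unfold eintegral
  rw [lintegral_congr_ae (g := fun x => ENNReal.ofReal (k x)),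
    lintegral_congr_ae (f := fun x => ENNReal.ofReal (-g x))
      (g := fun x => ENNReal.ofReal (-k x))]
  · filter_upwards [h] with x hx; rw [hx]
  · filter_upwards [h] with x hx; rw [hx]

/-- The integral of `g + k` with `g ≥ 0` and `k` integrable splits, whether or not `g` is
integrable. -/
theorem eintegral_add (hgm : AEMeasurable g μ) (hg : 0 ≤ᵐ[μ] g) (hk : Integrable k μ) :
    eintegral μ (fun x => g x + k x)
      = ((∫⁻ x, ENNReal.ofReal (g x) ∂μ : ENNReal) : EReal) + ((∫ x, k x ∂μ : ℝ) : EReal) := by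
  by_cases hfin : ∫⁻ x, ENNReal.ofReal (g x) ∂μ = ⊤
  · have h2 : ∫⁻ x, ENNReal.ofReal (-(g x + k x)) ∂μ ≠ ⊤ := by
      refine ((lintegral_mono_ae ?_).trans_lt hk.neg.lintegral_lt_top).ne
      filter_upwards [hg] with x hx
      refine ENNReal.ofReal_le_ofReal ?_
      have : 0 ≤ g x := hx
      simp only [Pi.neg_apply]; linarith
    have h1 : ∫⁻ x, ENNReal.ofReal (g x + k x) ∂μ = ⊤ := by
      by_contra h
      have h3 : ∫⁻ x, ENNReal.ofReal (g x) ∂μ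
          ≤ ∫⁻ x, ENNReal.ofReal (g x + k x) ∂μ + ∫⁻ x, ENNReal.ofReal (-k x) ∂μ := by
        rw [← lintegral_add_right' _ (by fun_prop)]
        refine lintegral_mono fun x => ?_
        refine le_trans (ENNReal.ofReal_le_ofReal ?_) ENNReal.ofReal_add_le
        linarith
      rw [hfin, top_le_iff, ENNReal.add_eq_top] at h3
      exact h3.elim h hk.neg.lintegral_lt_top.ne
    rw [eintegral, h1, hfin]
    lift ∫⁻ x, ENNReal.ofReal (-(g x + k x)) ∂μ to NNReal using h2 with y
    rfl
  · have hgi : Integrable g μ := by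
      refine ⟨hgm.aestronglyMeasurable, ?_⟩
      rw [hasFiniteIntegral_iff_ofReal hg]
      exact lt_top_iff_ne_top.2 hfin
    rw [show (fun x => g x + k x) = g + k from rfl, eintegral_of_integrable (hgi.add hk),
      integral_add' hgi hk, EReal.coe_add,
      integral_eq_lintegral_of_nonneg_ae hg hgm.aestronglyMeasurable,
      EReal.coe_ennreal_toReal hfin]

end Eintegral

/-- Convergence of integrals of nonnegative functions that converge from below. -/
theorem tendsto_lintegral_of_le {α ι : Type*} [MeasurableSpace α] {μ : Measure α} {l : Filter ι}
    [l.IsCountablyGenerated] {φ : ι → α → ENNReal} {φ₀ : α → ENNReal}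
    (hm : ∀ t, Measurable (φ t)) (hlim : ∀ᵐ s ∂μ, Tendsto (fun t => φ t s) l (𝓝 (φ₀ s)))
    (hle : ∀ᶠ t in l, ∀ᵐ s ∂μ, φ t s ≤ φ₀ s) :
    Tendsto (fun t => ∫⁻ s, φ t s ∂μ) l (𝓝 (∫⁻ s, φ₀ s ∂μ)) := by
  rcases l.eq_or_neBot with rfl | hl
  · simp
  refine tendsto_of_le_liminf_of_limsup_le ?_ ?_
  · refine le_trans (le_of_eq ?_) (lintegral_liminf_le hm)
    refine lintegral_congr_ae ?_
    filter_upwards [hlim] with s hs using hs.liminf_eq.symm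
  · refine limsup_le_of_le (by isBoundedDefault) ?_
    filter_upwards [hle] with t ht using lintegral_mono_ae ht

section Endpoints

variable {f : ℝ → ℝ}

/-- A convex function lies above its right tangent at `1`. -/
theorem taylor_nonneg (hf : ConvexOn ℝ (Ioi 0) f) {t : ℝ} (ht : 0 < t) :
    0 ≤ f t - f 1 - rderiv f 1 * (t - 1) := by
  have hmono := rderiv_monotoneOn hf
  have h1 : (1 : ℝ) ∈ Ioi (0 : ℝ) := mem_Ioi.2 one_pos
  rcases le_total 1 t with h | h
  · obtain ⟨hi, he⟩ := integral_rderiv hf one_pos h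
    have := intervalIntegral.integral_mono_on (f := fun _ => rderiv f 1) h (by simp) hi
      (fun x hx => hmono h1 (one_pos.trans_le hx.1) hx.1)
    rw [he] at this; simp at this; linarith
  · obtain ⟨hi, he⟩ := integral_rderiv hf ht h
    have := intervalIntegral.integral_mono_on (g := fun _ => rderiv f 1) h hi (by simp)
      (fun x hx => hmono (ht.trans_le hx.1) h1 hx.2)
    rw [he] at this; simp at this; linarith

/-- The hinge representation in the extended reals, for `f 1 = 0`. -/
theorem coe_eq_lintegral_hinge (hf : ConvexOn ℝ (Ioi 0) f) (hf1 : f 1 = 0) {t : ℝ} (ht : 0 < t) :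
    ((f t : ℝ) : EReal) = ((∫⁻ s, ENNReal.ofReal (hinge s t) ∂(lineCurvature hf) : ENNReal) : EReal)
      + ((rderiv f 1 * (t - 1) : ℝ) : EReal) := by
  rw [lintegral_hinge hf ht, EReal.coe_ennreal_ofReal, max_eq_left (taylor_nonneg hf ht),
    ← EReal.coe_add, hf1]
  congr 1; ring

/-- The sum is continuous in the extended reals, as its second summand stays finite. -/
theorem tendsto_coe_ennreal_add {ι : Type*} {l : Filter ι} {A : ι → ENNReal} {A₀ : ENNReal}
    {b : ι → ℝ} {b₀ : ℝ} (hA : Tendsto A l (𝓝 A₀)) (hb : Tendsto b l (𝓝 b₀)) :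
    Tendsto (fun t => ((A t : EReal) + (b t : EReal))) l (𝓝 ((A₀ : EReal) + (b₀ : EReal))) := by
  have h1 : Tendsto (fun t => (A t : EReal)) l (𝓝 (A₀ : EReal)) :=
    (continuous_coe_ennreal_ereal.tendsto A₀).comp hA
  have h2 : Tendsto (fun t => (b t : EReal)) l (𝓝 (b₀ : EReal)) :=
    (continuous_coe_real_ereal.tendsto b₀).comp hb
  exact (EReal.continuousAt_add (p := ((A₀ : EReal), (b₀ : EReal))) (Or.inr (by simp))
    (Or.inr (by simp))).tendsto.comp (h1.prodMk_nhds h2)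

theorem measurable_ofReal_hinge (t : ℝ) : Measurable fun s => ENNReal.ofReal (hinge s t) :=
  (measurable_hinge.comp (measurable_id.prodMk measurable_const)).ennreal_ofReal

/-- The value `f(0+)`: the hinge with corner `s ≤ 1` increases to `s` at `0`. -/
theorem limZero_eq (hf : ConvexOn ℝ (Ioi 0) f) (hf1 : f 1 = 0) :
    limZero f = ((∫⁻ s, ENNReal.ofReal (hinge s 0) ∂(lineCurvature hf) : ENNReal) : EReal)
      + ((-rderiv f 1 : ℝ) : EReal) := by
  refine Tendsto.limsup_eq ?_
  have h1 : Tendsto (fun t => ∫⁻ s, ENNReal.ofReal (hinge s t) ∂(lineCurvature hf)) (𝓝[>] 0)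
      (𝓝 (∫⁻ s, ENNReal.ofReal (hinge s 0) ∂(lineCurvature hf))) := by
    refine tendsto_lintegral_of_le measurable_ofReal_hinge ?_ ?_
    · refine Eventually.of_forall fun s => Tendsto.mono_left ?_ nhdsWithin_le_nhds
      refine (ENNReal.continuous_ofReal.comp ?_).tendsto 0
      unfold hinge; split_ifs <;> fun_prop
    · filter_upwards [Ioo_mem_nhdsGT (one_pos : (0 : ℝ) < 1)] with t ht
      refine Eventually.of_forall fun s => ?_
      unfold hinge
      split_ifs with h
      · exact ENNReal.ofReal_le_ofReal (by linarith [ht.1])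
      · rw [ENNReal.ofReal_of_nonpos (by linarith [ht.2])]; simp
  have h2 : Tendsto (fun t : ℝ => rderiv f 1 * (t - 1)) (𝓝[>] 0) (𝓝 (-rderiv f 1)) := by
    refine Tendsto.mono_left ?_ nhdsWithin_le_nhds
    have : Continuous fun t : ℝ => rderiv f 1 * (t - 1) := by fun_prop
    simpa using this.tendsto 0
  refine (tendsto_coe_ennreal_add h1 h2).congr' ?_
  filter_upwards [self_mem_nhdsWithin] with t ht
  exact (coe_eq_lintegral_hinge hf hf1 ht).symm

/-- The slope `f'(∞)`: each hinge with corner `s > 1` contributes its slope `1`. -/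
theorem slopeTop_eq (hf : ConvexOn ℝ (Ioi 0) f) (hf1 : f 1 = 0) :
    slopeTop f = ((∫⁻ s, (Ioi 1).indicator 1 s ∂(lineCurvature hf) : ENNReal) : EReal)
      + ((rderiv f 1 : ℝ) : EReal) := by
  refine Tendsto.limsup_eq ?_
  have hinv : Tendsto (fun t : ℝ => t⁻¹) atTop (𝓝 0) := tendsto_inv_atTop_zero
  have h1 : Tendsto (fun t => ∫⁻ s, ENNReal.ofReal (hinge s t / t) ∂(lineCurvature hf)) atTop
      (𝓝 (∫⁻ s, (Ioi 1).indicator 1 s ∂(lineCurvature hf))) := by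
    refine tendsto_lintegral_of_le (fun t => ?_) ?_ ?_
    · exact ((measurable_hinge.comp
        (measurable_id.prodMk measurable_const)).div_const t).ennreal_ofReal
    · refine Eventually.of_forall fun s => ?_
      by_cases h : 1 < s
      · rw [indicator_of_mem (mem_Ioi.2 h)]
        have : Tendsto (fun t : ℝ => 1 - s * t⁻¹) atTop (𝓝 1) := by
          simpa using (tendsto_const_nhds (x := (1 : ℝ))).sub (hinv.const_mul s)
        have h3 := (ENNReal.continuous_ofReal.tendsto 1).comp this
        rw [ENNReal.ofReal_one] at h3
        refine h3.congr' ?_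
        filter_upwards [eventually_gt_atTop 0] with t ht
        simp only [Function.comp, hinge, if_neg (not_le.2 h)]
        congr 1; field_simp
      · rw [indicator_of_notMem (by simpa using h)]
        refine tendsto_const_nhds.congr' ?_
        filter_upwards [eventually_gt_atTop 1] with t ht
        rw [hinge, if_pos (not_lt.1 h), ENNReal.ofReal_of_nonpos]
        exact div_nonpos_of_nonpos_of_nonneg (by linarith [not_lt.1 h]) (by linarith)
    · filter_upwards [eventually_gt_atTop 1] with t ht
      refine Eventually.of_forall fun s => ?_
      by_cases h : 1 < s
      · rw [indicator_of_mem (mem_Ioi.2 h), hinge, if_neg (not_le.2 h), Pi.one_apply,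
          ← ENNReal.ofReal_one]
        refine ENNReal.ofReal_le_ofReal ?_
        rw [div_le_one (by linarith)]; linarith
      · rw [hinge, if_pos (not_lt.1 h), ENNReal.ofReal_of_nonpos]
        · simp
        · exact div_nonpos_of_nonpos_of_nonneg (by linarith [not_lt.1 h]) (by linarith)
  have h2 : Tendsto (fun t : ℝ => rderiv f 1 * (1 - t⁻¹)) atTop (𝓝 (rderiv f 1)) := by
    simpa using ((tendsto_const_nhds (x := (1 : ℝ))).sub hinv).const_mul (rderiv f 1)
  refine (tendsto_coe_ennreal_add h1 h2).congr' ?_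
  filter_upwards [eventually_gt_atTop 0] with t ht
  have h3 : ∫⁻ s, ENNReal.ofReal (hinge s t / t) ∂(lineCurvature hf)
      = ENNReal.ofReal ((f t - f 1 - rderiv f 1 * (t - 1)) / t) := by
    simp_rw [ENNReal.ofReal_div_of_pos ht, div_eq_mul_inv]
    rw [lintegral_mul_const _ (measurable_ofReal_hinge t), lintegral_hinge hf ht]
  rw [h3, EReal.coe_ennreal_ofReal, max_eq_left (div_nonneg (taylor_nonneg hf ht) ht.le),
    ← EReal.coe_add, hf1]
  congr 1; field_simp; ring

end Endpoints

theorem limZero_fPrim {π : ℝ} (hπ : π ∈ Icc (0 : ℝ) 1) :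
    limZero (fPrim π) = ((min π (1 - π) : ℝ) : EReal) := by
  refine Tendsto.limsup_eq ?_
  refine (continuous_coe_real_ereal.tendsto _).comp ?_
  refine Tendsto.mono_left ?_ nhdsWithin_le_nhds
  have : Continuous (fPrim π) := by unfold fPrim; fun_prop
  convert this.tendsto 0 using 2
  simp [fPrim, hπ.2]

theorem slopeTop_fPrim {π : ℝ} (hπ : π ∈ Icc (0 : ℝ) 1) : slopeTop (fPrim π) = 0 := by
  refine Tendsto.limsup_eq ?_
  rw [← EReal.coe_zero]
  refine (continuous_coe_real_ereal.tendsto _).comp ?_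
  have hinv : Tendsto (fun t : ℝ => t⁻¹) atTop (𝓝 0) := tendsto_inv_atTop_zero
  refine squeeze_zero_norm' (a := fun t : ℝ => 1 * t⁻¹) ?_ (by simpa using hinv)
  filter_upwards [eventually_gt_atTop 0] with t ht
  rw [norm_div, Real.norm_eq_abs, Real.norm_eq_abs, abs_of_pos ht, div_eq_mul_inv]
  refine mul_le_mul_of_nonneg_right ?_ (by positivity)
  have h1 : 0 ≤ π * t := mul_nonneg hπ.1 ht.le
  have := hπ.1; have := hπ.2
  rw [fPrim, abs_le]
  constructor <;> rcases min_cases π (1 - π) with h | h <;>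
    rcases min_cases (1 - π) (π * t) with h' | h' <;> linarith

section Divergence

variable {X : Type*} [MeasurableSpace X] (P Q : Measure X)

/-- The likelihood ratio `dP/dQ` of the part of `P` that is absolutely continuous, as a real
function. -/
def lratio (x : X) : ℝ := (P.rnDeriv Q x).toReal

/-- The Bayes risk `∫ min {(1 - π) dQ, π dP}` of the test of `P`, with prior probability `π`,
against `Q`. -/
def bayesRisk (π : ℝ) : ℝ := ∫ x, min (1 - π) (π * lratio P Q x) ∂Q

theorem measurable_lratio : Measurable (lratio P Q) :=
  (Measure.measurable_rnDeriv P Q).ennreal_toReal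

theorem lratio_nonneg (x : X) : 0 ≤ lratio P Q x := ENNReal.toReal_nonneg

theorem measurableSet_rnDeriv_eq_zero : MeasurableSet {x | P.rnDeriv Q x = 0} :=
  Measure.measurable_rnDeriv P Q (measurableSet_singleton 0)

theorem measurable_bayesRisk [SFinite Q] : Measurable (bayesRisk P Q) := by
  refine StronglyMeasurable.measurable ?_
  refine StronglyMeasurable.integral_prod_right
    (f := fun (π : ℝ) (x : X) => min (1 - π) (π * lratio P Q x)) ?_
  have := measurable_lratio P Q
  refine Measurable.stronglyMeasurable ?_
  unfold Function.uncurry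
  fun_prop

theorem integrable_lratio [IsFiniteMeasure P] : Integrable (lratio P Q) Q :=
  Measure.integrable_toReal_rnDeriv

variable [IsProbabilityMeasure P] [IsProbabilityMeasure Q]

theorem integrable_min_lratio (a b : ℝ) : Integrable (fun x => min a (b * lratio P Q x)) Q :=
  (integrable_const a).inf ((integrable_lratio P Q).const_mul b)

theorem integral_lratio_add_singularPart :
    ∫ x, lratio P Q x ∂Q + (P.singularPart Q univ).toReal = 1 := by
  have h : (P.singularPart Q + Q.withDensity (P.rnDeriv Q)).real univ = 1 := by
    rw [Measure.singularPart_add_rnDeriv, probReal_univ]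
  rw [measureReal_add_apply (measure_ne_top _ _) (measure_ne_top _ _)] at h
  rw [add_comm, ← h]
  congr 1
  rw [Measure.real, withDensity_apply _ MeasurableSet.univ, Measure.restrict_univ,
    ← integral_toReal (Measure.measurable_rnDeriv P Q).aemeasurable (Measure.rnDeriv_lt_top P Q)]
  rfl

/-- The primitive divergence is the Bayes risk without data, minus the Bayes risk with data. -/
theorem genVar_eq {π : ℝ} (hπ : π ∈ Icc (0 : ℝ) 1) :
    genVar π P Q = min π (1 - π) - bayesRisk P Q π := by
  have hms := measurableSet_rnDeriv_eq_zero P Q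
  have hint : Integrable (fun x => fPrim π (lratio P Q x)) Q :=
    (integrable_const _).sub (integrable_min_lratio P Q _ _)
  have h0 : ∫ x in {x | P.rnDeriv Q x = 0}, fPrim π (lratio P Q x) ∂Q
      = min π (1 - π) * (Q {x | P.rnDeriv Q x = 0}).toReal := by
    rw [setIntegral_congr_fun (g := fun _ => min π (1 - π)) hms]
    · rw [setIntegral_const, smul_eq_mul, mul_comm]; rfl
    · intro x hx
      have : P.rnDeriv Q x = 0 := hx
      simp [lratio, fPrim, this, hπ.2]
  have h1 := integral_add_compl hms hint
  have h2 : ∫ x, fPrim π (lratio P Q x) ∂Q = min π (1 - π) - bayesRisk P Q π := by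
    unfold fPrim
    rw [integral_sub (integrable_const _) (integrable_min_lratio P Q _ _)]
    simp [bayesRisk]
  have h3 : {x | P.rnDeriv Q x = 0}ᶜ = {x | P.rnDeriv Q x ≠ 0} := rfl
  have h4 : ((Q {x | P.rnDeriv Q x = 0} : ENNReal) : EReal)
      = (((Q {x | P.rnDeriv Q x = 0}).toReal : ℝ) : EReal) :=
    (EReal.coe_ennreal_toReal (measure_ne_top _ _)).symm
  rw [genVar, fDiv, limZero_fPrim hπ, slopeTop_fPrim hπ, zero_mul, add_zero, h4, ← EReal.coe_mul,
    ← h0, ← h2, ← h1, h3, add_comm (integral _ _)]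
  have h5 := eintegral_of_integrable (hint.restrict (s := {x | P.rnDeriv Q x ≠ 0}))
  unfold lratio at h5 ⊢
  rw [h5, ← EReal.coe_add, EReal.toReal_coe]

/-- The divergence of the hinge with corner `s` is, up to the factor `1 + s`, the primitive
divergence with parameter `1 / (1 + s)`. The singular part of `P` counts only for corners `s > 1`,
where the hinge has slope `1` at infinity. -/
theorem lintegral_hinge_lratio {s : ℝ} (hs : 0 < s) :
    ∫⁻ x, ENNReal.ofReal (hinge s (lratio P Q x)) ∂Q
        + (Ioi 1).indicator 1 s * P.singularPart Q univ
      = ENNReal.ofReal (1 + s) * ENNReal.ofReal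
          (min (1 / (1 + s)) (1 - 1 / (1 + s)) - bayesRisk P Q (1 / (1 + s))) := by
  have h1s : 0 < 1 + s := by linarith
  have hint : Integrable (fun x => min s (lratio P Q x)) Q := by
    simpa using integrable_min_lratio P Q s 1
  have hL : (1 + s) * bayesRisk P Q (1 / (1 + s)) = ∫ x, min s (lratio P Q x) ∂Q := by
    rw [bayesRisk, ← integral_const_mul]
    refine integral_congr_ae (Eventually.of_forall fun x => ?_)
    simp only []
    rw [← mul_min_of_nonneg _ _ h1s.le |>.symm]
    congr 1
    · field_simp; ring
    · field_simp
  rw [← ENNReal.ofReal_mul h1s.le, mul_sub, hL, mul_min_of_nonneg _ _ h1s.le,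
    show (1 + s) * (1 / (1 + s)) = 1 by field_simp,
    show (1 + s) * (1 - 1 / (1 + s)) = s by field_simp; ring]
  by_cases h : s ≤ 1
  · rw [indicator_of_notMem (by simpa using h), zero_mul, add_zero, min_eq_right h]
    have : ∀ x, ENNReal.ofReal (hinge s (lratio P Q x))
        = ENNReal.ofReal (s - min s (lratio P Q x)) := by
      intro x
      rw [hinge, if_pos h]
      rcases le_total s (lratio P Q x) with h' | h'
      · rw [min_eq_left h', sub_self, ENNReal.ofReal_zero, ENNReal.ofReal_of_nonpos (by linarith)]
      · rw [min_eq_right h']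
    simp_rw [this]
    have hi : Integrable (fun x => s - min s (lratio P Q x)) Q := (integrable_const s).sub hint
    rw [← ofReal_integral_eq_lintegral_ofReal hi, integral_sub (integrable_const s) hint]
    · simp
    · exact Eventually.of_forall fun x => sub_nonneg.2 (min_le_left _ _)
  · have h' := not_le.1 h
    rw [indicator_of_mem (mem_Ioi.2 h'), min_eq_left h'.le, Pi.one_apply, one_mul]
    have : ∀ x, ENNReal.ofReal (hinge s (lratio P Q x))
        = ENNReal.ofReal (lratio P Q x - min s (lratio P Q x)) := by
      intro x
      rw [hinge, if_neg h]
      rcases le_total s (lratio P Q x) with h' | h'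
      · rw [min_eq_left h']
      · rw [min_eq_right h', sub_self, ENNReal.ofReal_zero, ENNReal.ofReal_of_nonpos (by linarith)]
    have hpos : ∀ x, 0 ≤ lratio P Q x - min s (lratio P Q x) :=
      fun x => sub_nonneg.2 (min_le_right _ _)
    simp_rw [this]
    have hi : Integrable (fun x => lratio P Q x - min s (lratio P Q x)) Q :=
      (integrable_lratio P Q).sub hint
    rw [← ofReal_integral_eq_lintegral_ofReal hi
        (Eventually.of_forall hpos),
      ← ENNReal.ofReal_toReal (measure_ne_top (P.singularPart Q) univ),
      ← ENNReal.ofReal_add (integral_nonneg hpos) ENNReal.toReal_nonneg,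
      integral_sub (integrable_lratio P Q) hint, ← integral_lratio_add_singularPart P Q]
    congr 1; ring

/-- **Integral representation** of `f`-divergences: `I_f(P, Q) = ∫ V_π(P, Q) γ_f(dπ)`. -/
theorem fDiv_eq_lintegral {f : ℝ → ℝ} (hf : ConvexOn ℝ (Ioi 0) f) (hf1 : f 1 = 0) :
    fDiv f P Q = ((∫⁻ π, ENNReal.ofReal (min π (1 - π) - bayesRisk P Q π) ∂(weight hf) : ENNReal)
      : EReal) := by
  have hms := measurableSet_rnDeriv_eq_zero P Q
  set Z : Set X := {x | P.rnDeriv Q x = 0} with hZ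
  have hZc : {x | P.rnDeriv Q x ≠ 0} = Zᶜ := rfl
  set c := rderiv f 1 with hc
  set G₀ := ∫⁻ s, ENNReal.ofReal (hinge s 0) ∂(lineCurvature hf) with hG₀
  set G₁ := ∫⁻ s, (Ioi (1 : ℝ)).indicator (1 : ℝ → ENNReal) s ∂(lineCurvature hf) with hG₁
  set H : X → ENNReal := fun x => ∫⁻ s, ENNReal.ofReal (hinge s (lratio P Q x)) ∂(lineCurvature hf)
    with hH
  have hpos : ∀ᵐ x ∂(Q.restrict Zᶜ), 0 < lratio P Q x := by
    filter_upwards [ae_restrict_mem hms.compl, ae_restrict_of_ae (Measure.rnDeriv_lt_top P Q)]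
      with x hx hx'
    exact ENNReal.toReal_pos hx hx'.ne
  have hki : Integrable (fun x => c * (lratio P Q x - 1)) Q :=
    ((integrable_lratio P Q).sub (integrable_const 1)).const_mul c
  -- the absolutely continuous part; the ratio is positive there, so the hinge representation of
  -- `f` applies
  have hac : eintegral (Q.restrict Zᶜ) (fun x => f (P.rnDeriv Q x).toReal)
      = ((∫⁻ x in Zᶜ, H x ∂Q : ENNReal) : EReal)
        + ((∫ x in Zᶜ, c * (lratio P Q x - 1) ∂Q : ℝ) : EReal) := by
    have h1 : (fun x => f (P.rnDeriv Q x).toReal) =ᵐ[Q.restrict Zᶜ]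
        fun x => (H x).toReal + c * (lratio P Q x - 1) := by
      filter_upwards [hpos] with x hx
      simp only [hH]
      rw [lintegral_hinge hf hx, ENNReal.toReal_ofReal (taylor_nonneg hf hx), hf1]
      unfold lratio; ring
    have hHm : Measurable H := by
      refine Measurable.lintegral_prod_right'
        (f := fun q : X × ℝ => ENNReal.ofReal (hinge q.2 (lratio P Q q.1))) ?_
      exact (measurable_hinge.comp
        (measurable_snd.prodMk ((measurable_lratio P Q).comp measurable_fst))).ennreal_ofReal
    rw [eintegral_congr h1, eintegral_add hHm.ennreal_toReal.aemeasurable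
      (Eventually.of_forall fun x => ENNReal.toReal_nonneg) hki.restrict]
    congr 2
    refine lintegral_congr_ae ?_
    filter_upwards [hpos] with x hx
    refine ENNReal.ofReal_toReal ?_
    simp only [hH]
    rw [lintegral_hinge hf hx]
    exact ENNReal.ofReal_ne_top
  -- the linear parts cancel, as `P` and `Q` have the same mass
  have hlin : ∫ x in Zᶜ, c * (lratio P Q x - 1) ∂Q + (Q Z).toReal * (-c)
      + (P.singularPart Q univ).toReal * c = 0 := by
    have h1 := integral_add_compl hms hki
    have h2 : ∫ x in Z, c * (lratio P Q x - 1) ∂Q = (Q Z).toReal * (-c) := by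
      rw [setIntegral_congr_fun (g := fun _ => -c) hms]
      · rw [setIntegral_const, smul_eq_mul]; rfl
      · intro x hx
        have : P.rnDeriv Q x = 0 := hx
        simp [lratio, this]
    have h3 : ∫ x, c * (lratio P Q x - 1) ∂Q = c * (∫ x, lratio P Q x ∂Q - 1) := by
      rw [integral_const_mul, integral_sub (integrable_lratio P Q) (integrable_const 1)]
      simp
    have h4 := integral_lratio_add_singularPart P Q
    rw [← h2, add_comm (integral _ _), h1, h3, ← h4]; ring
  have hdist : ∀ (A m : ENNReal) (b : ℝ), m ≠ ⊤ → ((A : EReal) + (b : EReal)) * (m : EReal)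
      = ((A * m : ENNReal) : EReal) + ((m.toReal * b : ℝ) : EReal) := by
    intro A m b hm
    rw [mul_comm, EReal.left_distrib_of_nonneg_of_ne_top (EReal.coe_ennreal_nonneg m)
      (by simpa using hm), EReal.coe_mul, EReal.coe_ennreal_toReal hm, EReal.coe_ennreal_mul,
      mul_comm (A : EReal)]
  have hsum : fDiv f P Q = ((∫⁻ x in Zᶜ, H x ∂Q + G₀ * Q Z + G₁ * P.singularPart Q univ : ENNReal)
      : EReal) := by
    rw [fDiv, hZc, hac, limZero_eq hf hf1, slopeTop_eq hf hf1,
      hdist _ _ _ (measure_ne_top _ _), hdist _ _ _ (measure_ne_top _ _), EReal.coe_ennreal_add,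
      EReal.coe_ennreal_add]
    set A : EReal := ((∫⁻ x in Zᶜ, H x ∂Q : ENNReal) : EReal)
    calc _ = A + ((G₀ * Q Z : ENNReal) : EReal)
          + ((G₁ * P.singularPart Q univ : ENNReal) : EReal)
          + (((∫ x in Zᶜ, c * (lratio P Q x - 1) ∂Q : ℝ) : EReal)
          + (((Q Z).toReal * (-c) : ℝ) : EReal)
          + (((P.singularPart Q univ).toReal * c : ℝ) : EReal)) := by abel
      _ = _ := by
        rw [← EReal.coe_add, ← EReal.coe_add, hlin, EReal.coe_zero, add_zero]
  rw [hsum]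
  congr 1
  -- on `Z` the ratio is `0`, so the boundary term completes the integral over `Zᶜ`
  have hGZ : G₀ * Q Z = ∫⁻ x in Z, H x ∂Q := by
    rw [setLIntegral_congr_fun (g := fun _ => G₀) hms, setLIntegral_const]
    intro x hx
    have : P.rnDeriv Q x = 0 := hx
    simp [hH, hG₀, lratio, this]
  have hmeas : Measurable (Function.uncurry
      fun (x : X) (s : ℝ) => ENNReal.ofReal (hinge s (lratio P Q x))) :=
    (measurable_hinge.comp
        (measurable_snd.prodMk ((measurable_lratio P Q).comp measurable_fst))).ennreal_ofReal
  have hφ : Measurable fun π => ENNReal.ofReal (min π (1 - π) - bayesRisk P Q π) :=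
    ((by fun_prop : Measurable fun π : ℝ => min π (1 - π)).sub
        (measurable_bayesRisk P Q)).ennreal_ofReal
  rw [hGZ, add_comm (lintegral _ _), lintegral_add_compl _ hms, hH,
    lintegral_lintegral_swap hmeas.aemeasurable, hG₁,
    ← lintegral_mul_const _ (measurable_one.indicator measurableSet_Ioi),
    ← lintegral_add_right _
      ((measurable_one.indicator measurableSet_Ioi).mul_const _), lintegral_weight hf hφ]
  refine lintegral_congr_ae ?_
  filter_upwards [ae_lineCurvature_pos hf] with s hs
  exact lintegral_hinge_lratio P Q hs

end Divergence

/-! ### The envelope of the lines with admissible slopes -/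

section Envelope

variable {n : ℕ}

theorem pad_zero (l r : ℝ) (v : Fin n → ℝ) : pad l r v 0 = l := by simp [pad]

theorem pad_last (l r : ℝ) (v : Fin n → ℝ) : pad l r v (n + 1) = r := by simp [pad]

theorem pad_succ (l r : ℝ) (v : Fin n → ℝ) (i : Fin n) : pad l r v (i + 1) = v i := by
  simp [pad]

theorem node_zero (p : Fin n → ℝ) : node p 0 = 0 := pad_zero _ _ _
theorem node_last (p : Fin n → ℝ) : node p (n + 1) = 1 := pad_last _ _ _
theorem slp_zero (a : Fin n → ℝ) : slp a 0 = 1 := pad_zero _ _ _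
theorem slp_last (a : Fin n → ℝ) : slp a (n + 1) = -1 := pad_last _ _ _

theorem node_lt_node_succ {p : Fin n → ℝ} (hp : StrictMono p) (hp01 : ∀ i, p i ∈ Ioo (0 : ℝ) 1)
    {k : ℕ} (hk : k ≤ n) : node p k < node p (k + 1) := by
  rcases Nat.eq_zero_or_pos k with rfl | hk0
  · rw [node_zero]
    rcases Nat.eq_zero_or_pos n with rfl | hn
    · rw [node_last]; exact one_pos
    · exact (hp01 ⟨0, hn⟩).1.trans_eq (pad_succ 0 1 p ⟨0, hn⟩).symm
  · obtain ⟨m, rfl⟩ : ∃ m, k = m + 1 := ⟨k - 1, by omega⟩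
    rw [show node p (m + 1) = p ⟨m, hk⟩ from pad_succ 0 1 p ⟨m, hk⟩]
    rcases hk.lt_or_eq with h | h
    · rw [show node p (m + 1 + 1) = p ⟨m + 1, h⟩ from pad_succ 0 1 p ⟨m + 1, h⟩]
      exact hp (Fin.mk_lt_mk.2 (Nat.lt_succ_self m))
    · subst h
      rw [node_last]; exact (hp01 _).2

/-- Admissible values at the nodes of a concave function on `[0, 1]` that lies below
`min {π, 1 - π}`. Concavity itself is not required: it is implied by the box being nonempty. -/
structure IsRiskProfile (p : Fin n → ℝ) (ψ : ℕ → ℝ) : Prop where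
  pos : 0 < n
  node_lt : ∀ k ≤ n, node p k < node p (k + 1)
  zero : ψ 0 = 0
  last : ψ (n + 1) = 0
  le_left : ∀ k ≤ n + 1, ψ k ≤ node p k
  le_right : ∀ k ≤ n + 1, ψ k ≤ 1 - node p k

/-- The concave piecewise affine function with values `ψ_i` and slopes `a_i` at the nodes `π_i`,
written as a sum over its kinks. The `k`-th kink has the weight `a_k - a_{k+1}` and the abscissa
`π̃_k`; in this form the function is continuous in `a` and is the Bayes risk of a pair of
discrete measures. -/
def envelope (p : Fin n → ℝ) (ψ : ℕ → ℝ) (a : Fin n → ℝ) (x : ℝ) : ℝ :=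
  ∑ k ∈ Finset.range (n + 1),
    min (ψ (k + 1) - ψ k + slp a k * node p k - slp a (k + 1) * node p (k + 1))
      ((slp a k - slp a (k + 1)) * x) - x

variable {p : Fin n → ℝ} {ψ : ℕ → ℝ} {a : Fin n → ℝ}

theorem IsRiskProfile.node_mono (h : IsRiskProfile p ψ) {i k : ℕ} (hik : i ≤ k)
    (hk : k ≤ n + 1) : node p i ≤ node p k := by
  induction k, hik using Nat.le_induction with
  | base => exact le_rfl
  | succ m hm ih => exact (ih (by omega)).trans (h.node_lt m (by omega)).le

theorem IsRiskProfile.node_nonneg (h : IsRiskProfile p ψ) {k : ℕ} (hk : k ≤ n + 1) :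
    0 ≤ node p k := (node_zero p).symm.trans_le (h.node_mono (Nat.zero_le k) hk)

theorem IsRiskProfile.node_le_one (h : IsRiskProfile p ψ) {k : ℕ} (hk : k ≤ n + 1) :
    node p k ≤ 1 := (h.node_mono hk le_rfl).trans_eq (node_last p)

/-- The box, with the divisions cleared. -/
theorem mem_box_iff (h : IsRiskProfile p ψ) : a ∈ box p ψ ↔
    ∀ i, 1 ≤ i → i ≤ n →
      ψ (i + 1) - ψ i ≤ slp a i * (node p (i + 1) - node p i) ∧
        slp a i * (node p i - node p (i - 1)) ≤ ψ i - ψ (i - 1) := by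
  have key : ∀ i, 1 ≤ i → i ≤ n →
      (((ψ (i + 1) - ψ i) / (node p (i + 1) - node p i) ≤ slp a i ∧
        slp a i ≤ (ψ i - ψ (i - 1)) / (node p i - node p (i - 1))) ↔
      (ψ (i + 1) - ψ i ≤ slp a i * (node p (i + 1) - node p i) ∧
        slp a i * (node p i - node p (i - 1)) ≤ ψ i - ψ (i - 1))) := by
    intro i hi hin
    have h1 : 0 < node p (i + 1) - node p i := sub_pos.2 (h.node_lt i hin)
    have h2 : 0 < node p i - node p (i - 1) := by
      have := h.node_lt (i - 1) (by omega)
      rw [Nat.sub_add_cancel hi] at this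
      exact sub_pos.2 this
    rw [div_le_iff₀ h1, le_div_iff₀ h2]
  constructor
  · intro ha i hi hin
    exact (key i hi hin).1 (ha i (Finset.mem_Icc.2 ⟨hi, hin⟩))
  · intro ha i hi
    obtain ⟨hi, hin⟩ := Finset.mem_Icc.1 hi
    exact (key i hi hin).2 (ha i hi hin)

theorem le_slp_mul (h : IsRiskProfile p ψ) (ha : a ∈ box p ψ) {k : ℕ} (hk : k ≤ n) :
    ψ (k + 1) - ψ k ≤ slp a k * (node p (k + 1) - node p k) := by
  rcases Nat.eq_zero_or_pos k with rfl | hk0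
  · have := h.le_left 1 (by omega)
    simp only [slp_zero, node_zero, h.zero, zero_add]; linarith
  · exact ((mem_box_iff h).1 ha k hk0 hk).1

theorem slp_succ_mul_le (h : IsRiskProfile p ψ) (ha : a ∈ box p ψ) {k : ℕ} (hk : k ≤ n) :
    slp a (k + 1) * (node p (k + 1) - node p k) ≤ ψ (k + 1) - ψ k := by
  rcases hk.lt_or_eq with hk | rfl
  · exact ((mem_box_iff h).1 ha (k + 1) (by omega) hk).2
  · have := h.le_right k (by omega)
    simp only [slp_last, node_last, h.last]; linarith

theorem slp_succ_le (h : IsRiskProfile p ψ) (ha : a ∈ box p ψ) {k : ℕ} (hk : k ≤ n) :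
    slp a (k + 1) ≤ slp a k :=
  le_of_mul_le_mul_right ((slp_succ_mul_le h ha hk).trans (le_slp_mul h ha hk))
    (sub_pos.2 (h.node_lt k hk))

theorem slp_antitone (h : IsRiskProfile p ψ) (ha : a ∈ box p ψ) {i k : ℕ} (hik : i ≤ k)
    (hk : k ≤ n + 1) : slp a k ≤ slp a i := by
  induction k, hik using Nat.le_induction with
  | base => exact le_rfl
  | succ m hm ih => exact (slp_succ_le h ha (by omega)).trans (ih (by omega))

theorem slp_mem_Icc (h : IsRiskProfile p ψ) (ha : a ∈ box p ψ) {k : ℕ} (hk : k ≤ n + 1) :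
    slp a k ∈ Icc (-1 : ℝ) 1 :=
  ⟨(slp_last a).symm.trans_le (slp_antitone h ha hk le_rfl),
    (slp_antitone h ha (Nat.zero_le k) hk).trans_eq (slp_zero a)⟩

/-- The defining property of the kink `π̃_k`, also when the two slopes agree: then the two
points lie on one line. -/
theorem mul_tildePi (h : IsRiskProfile p ψ) (ha : a ∈ box p ψ) {k : ℕ} (hk : k ≤ n) :
    (slp a k - slp a (k + 1)) * tildePi p ψ a k
      = ψ (k + 1) - ψ k + slp a k * node p k - slp a (k + 1) * node p (k + 1) := by
  rw [tildePi]
  split_ifs with heq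
  · have h1 := le_slp_mul h ha hk
    have h2 := slp_succ_mul_le h ha hk
    rw [heq] at h2 ⊢
    linarith
  · have : slp a (k + 1) - slp a k ≠ 0 := sub_ne_zero.2 heq
    field_simp
    ring

theorem node_le_tildePi (h : IsRiskProfile p ψ) (ha : a ∈ box p ψ) {k : ℕ} (hk : k ≤ n) :
    node p k ≤ tildePi p ψ a k := by
  by_cases heq : slp a (k + 1) = slp a k
  · rw [tildePi, if_pos heq]
  · have hw : 0 < slp a k - slp a (k + 1) :=
      sub_pos.2 (lt_of_le_of_ne (slp_succ_le h ha hk) heq)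
    refine le_of_mul_le_mul_left ?_ hw
    rw [mul_tildePi h ha hk]
    linarith [slp_succ_mul_le h ha hk]

theorem tildePi_le_node_succ (h : IsRiskProfile p ψ) (ha : a ∈ box p ψ) {k : ℕ} (hk : k ≤ n) :
    tildePi p ψ a k ≤ node p (k + 1) := by
  by_cases heq : slp a (k + 1) = slp a k
  · rw [tildePi, if_pos heq]; exact (h.node_lt k hk).le
  · have hw : 0 < slp a k - slp a (k + 1) :=
      sub_pos.2 (lt_of_le_of_ne (slp_succ_le h ha hk) heq)
    refine le_of_mul_le_mul_left ?_ hw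
    rw [mul_tildePi h ha hk]
    linarith [le_slp_mul h ha hk]

theorem tildePi_mono (h : IsRiskProfile p ψ) (ha : a ∈ box p ψ) {i k : ℕ} (hik : i ≤ k)
    (hk : k ≤ n) : tildePi p ψ a i ≤ tildePi p ψ a k := by
  induction k, hik using Nat.le_induction with
  | base => exact le_rfl
  | succ m hm ih =>
    exact (ih (by omega)).trans ((tildePi_le_node_succ h ha (by omega)).trans
      (node_le_tildePi h ha hk))

/-- The line of slope `a_k` through `(π_k, ψ_k)` passes below the apex `(1/2, 1/2)` of
`min {π, 1 - π}`. -/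
theorem line_half_le (h : IsRiskProfile p ψ) (ha : a ∈ box p ψ) {k : ℕ} (hk : k ≤ n + 1) :
    2 * ψ k ≤ 2 * slp a k * node p k + 1 - slp a k := by
  have h1 := slp_mem_Icc h ha hk
  have h2 := mul_le_mul_of_nonneg_left (h.le_left k hk) (by linarith [h1.1] : 0 ≤ 1 + slp a k)
  have h3 := mul_le_mul_of_nonneg_left (h.le_right k hk) (by linarith [h1.2] : 0 ≤ 1 - slp a k)
  linarith

theorem tildePi_zero_le_half (h : IsRiskProfile p ψ) (ha : a ∈ box p ψ) :
    tildePi p ψ a 0 ≤ 1 / 2 := by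
  by_cases heq : slp a (0 + 1) = slp a 0
  · rw [tildePi, if_pos heq, node_zero]; norm_num
  · have hw : 0 < slp a 0 - slp a (0 + 1) :=
      sub_pos.2 (lt_of_le_of_ne (slp_succ_le h ha (Nat.zero_le n)) heq)
    refine le_of_mul_le_mul_left ?_ hw
    rw [mul_tildePi h ha (Nat.zero_le n)]
    have := line_half_le h ha (k := 0 + 1) (by omega)
    rw [slp_zero, node_zero, h.zero]
    linarith

theorem half_le_tildePi_last (h : IsRiskProfile p ψ) (ha : a ∈ box p ψ) :
    1 / 2 ≤ tildePi p ψ a n := by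
  by_cases heq : slp a (n + 1) = slp a n
  · rw [tildePi, if_pos heq]
    have h1 := le_slp_mul h ha le_rfl
    rw [← heq, slp_last, node_last, h.last] at h1
    linarith [h.le_left n (by omega)]
  · have hw : 0 < slp a n - slp a (n + 1) :=
      sub_pos.2 (lt_of_le_of_ne (slp_succ_le h ha le_rfl) heq)
    refine le_of_mul_le_mul_left ?_ hw
    rw [mul_tildePi h ha le_rfl]
    have := line_half_le h ha (k := n) (by omega)
    rw [slp_last, node_last, h.last]
    linarith

theorem sum_kink_fst (p : Fin n → ℝ) (ψ : ℕ → ℝ) (a : Fin n → ℝ) (i : ℕ) :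
    ∑ k ∈ Finset.range i,
      (ψ (k + 1) - ψ k + slp a k * node p k - slp a (k + 1) * node p (k + 1))
      = ψ i - ψ 0 + slp a 0 * node p 0 - slp a i * node p i := by
  induction i with
  | zero => simp
  | succ i ih => rw [Finset.sum_range_succ, ih]; ring

theorem sum_kink_weight (a : Fin n → ℝ) (i : ℕ) :
    ∑ k ∈ Finset.range i, (slp a k - slp a (k + 1)) = slp a 0 - slp a i := by
  induction i with
  | zero => simp
  | succ i ih => rw [Finset.sum_range_succ, ih]; ring

/-- Between the kinks `π̃_{i-1}` and `π̃_i` the envelope is the line of slope `a_i` through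
`(π_i, ψ_i)`. -/
theorem envelope_eq_line (h : IsRiskProfile p ψ) (ha : a ∈ box p ψ) {i : ℕ} (hi : i ≤ n + 1)
    {x : ℝ} (hl : ∀ k < i, tildePi p ψ a k ≤ x) (hr : ∀ k, i ≤ k → k ≤ n → x ≤ tildePi p ψ a k) :
    envelope p ψ a x = ψ i + slp a i * (x - node p i) := by
  have h1 : ∑ k ∈ Finset.range i,
      min (ψ (k + 1) - ψ k + slp a k * node p k - slp a (k + 1) * node p (k + 1))
        ((slp a k - slp a (k + 1)) * x) = ψ i + node p 0 - slp a i * node p i := by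
    have h2 := sum_kink_fst p ψ a i
    rw [h.zero, slp_zero, one_mul, sub_zero] at h2
    rw [← h2]
    refine Finset.sum_congr rfl fun k hk => ?_
    have hk' := Finset.mem_range.1 hk
    refine min_eq_left ?_
    rw [← mul_tildePi h ha (by omega)]
    exact mul_le_mul_of_nonneg_left (hl k hk') (sub_nonneg.2 (slp_succ_le h ha (by omega)))
  have h2 : ∑ k ∈ Finset.Ico i (n + 1),
      min (ψ (k + 1) - ψ k + slp a k * node p k - slp a (k + 1) * node p (k + 1))
        ((slp a k - slp a (k + 1)) * x) = (slp a i + 1) * x := by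
    have h3 : (slp a i + 1) * x
        = ∑ k ∈ Finset.Ico i (n + 1), (slp a k - slp a (k + 1)) * x := by
      rw [← Finset.sum_mul, Finset.sum_Ico_eq_sub _ hi, sum_kink_weight, sum_kink_weight, slp_last]
      ring
    rw [h3]
    refine Finset.sum_congr rfl fun k hk => ?_
    have hk' := Finset.mem_Ico.1 hk
    refine min_eq_right ?_
    rw [← mul_tildePi h ha (by omega)]
    exact mul_le_mul_of_nonneg_left (hr k hk'.1 (by omega))
      (sub_nonneg.2 (slp_succ_le h ha (by omega)))
  rw [envelope, ← Finset.sum_range_add_sum_Ico _ hi, h1, h2, node_zero]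
  ring

/-- Every point lies between two consecutive kinks. -/
theorem exists_envelope_eq_line (h : IsRiskProfile p ψ) (ha : a ∈ box p ψ) (x : ℝ) :
    ∃ i ≤ n + 1, envelope p ψ a x = ψ i + slp a i * (x - node p i) := by
  have hex : ∃ i, i = n + 1 ∨ x ≤ tildePi p ψ a i := ⟨n + 1, Or.inl rfl⟩
  classical
  have hmin : Nat.find hex ≤ n + 1 := Nat.find_min' hex (Or.inl rfl)
  refine ⟨Nat.find hex, hmin, envelope_eq_line h ha hmin (fun k hk => ?_) fun k hk hkn => ?_⟩
  · have := Nat.find_min hex hk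
    push Not at this
    exact this.2.le
  · rcases Nat.find_spec hex with h' | h'
    · omega
    · exact h'.trans (tildePi_mono h ha hk hkn)

/-- The envelope interpolates the given values. -/
theorem envelope_node (h : IsRiskProfile p ψ) (ha : a ∈ box p ψ) {i : ℕ} (hi : i ≤ n + 1) :
    envelope p ψ a (node p i) = ψ i := by
  rw [envelope_eq_line h ha hi, sub_self, mul_zero, add_zero]
  · intro k hk
    exact (tildePi_le_node_succ h ha (by omega)).trans (h.node_mono hk hi)
  · intro k hk hkn
    exact (h.node_mono hk (by omega)).trans (node_le_tildePi h ha hkn)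

/-- Bounding all minima by the second entry gives `π`, by the first entry `1 - π`. -/
theorem envelope_le (h : IsRiskProfile p ψ) (a : Fin n → ℝ) (x : ℝ) :
    envelope p ψ a x ≤ min x (1 - x) := by
  refine le_min ?_ ?_
  · have := Finset.sum_le_sum (s := Finset.range (n + 1)) fun k _ => min_le_right
      (ψ (k + 1) - ψ k + slp a k * node p k - slp a (k + 1) * node p (k + 1))
      ((slp a k - slp a (k + 1)) * x)
    rw [← Finset.sum_mul, sum_kink_weight, slp_zero, slp_last] at this
    unfold envelope; linarith
  · have := Finset.sum_le_sum (s := Finset.range (n + 1)) fun k _ => min_le_left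
      (ψ (k + 1) - ψ k + slp a k * node p k - slp a (k + 1) * node p (k + 1))
      ((slp a k - slp a (k + 1)) * x)
    rw [sum_kink_fst, h.zero, h.last, node_zero, slp_last, node_last] at this
    unfold envelope; linarith

theorem continuous_envelope_slopes (p : Fin n → ℝ) (ψ : ℕ → ℝ) (x : ℝ) :
    Continuous fun a => envelope p ψ a x := by
  have hs : ∀ k, Continuous fun a : Fin n → ℝ => slp a k := by
    intro k
    unfold slp pad
    split_ifs <;> fun_prop
  unfold envelope
  refine Continuous.sub (continuous_finsetSum _ fun k _ => ?_) continuous_const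
  have := hs k
  have := hs (k + 1)
  fun_prop

theorem continuous_envelope (p : Fin n → ℝ) (ψ : ℕ → ℝ) (a : Fin n → ℝ) :
    Continuous (envelope p ψ a) := by
  unfold envelope; fun_prop

/-! ### The objective as one integral -/

theorem jIdx_spec (h : IsRiskProfile p ψ) (ha : a ∈ box p ψ) :
    1 ≤ jIdx p ψ a ∧ jIdx p ψ a ≤ n ∧ 1 / 2 ≤ tildePi p ψ a (jIdx p ψ a) :=
  Nat.sInf_mem (s := {k | 1 ≤ k ∧ k ≤ n ∧ 1 / 2 ≤ tildePi p ψ a k})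
    ⟨n, h.pos, le_rfl, half_le_tildePi_last h ha⟩

/-- The kinks before `j` lie to the left of `1/2`, also the kink with the index `0`, which the
definition of `j` does not test. -/
theorem tildePi_le_half (h : IsRiskProfile p ψ) (ha : a ∈ box p ψ) {k : ℕ}
    (hk : k < jIdx p ψ a) : tildePi p ψ a k ≤ 1 / 2 := by
  rcases Nat.eq_zero_or_pos k with rfl | hk0
  · exact tildePi_zero_le_half h ha
  · by_contra hc
    have := (jIdx_spec h ha).2.1
    exact Nat.notMem_of_lt_sInf hk ⟨hk0, by omega, (not_le.1 hc).le⟩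

theorem barPi_of_lt {i : ℕ} (hi : i < jIdx p ψ a) : barPi p ψ a i = tildePi p ψ a i := by
  rw [barPi, if_pos hi]

theorem barPi_jIdx : barPi p ψ a (jIdx p ψ a) = 1 / 2 := by
  rw [barPi, if_neg (lt_irrefl _), if_pos rfl]

theorem barPi_of_gt {i : ℕ} (hi : jIdx p ψ a < i) : barPi p ψ a i = tildePi p ψ a (i - 1) := by
  rw [barPi, if_neg (by omega), if_neg (by omega)]

theorem barPi_zero (h : IsRiskProfile p ψ) (ha : a ∈ box p ψ) :
    barPi p ψ a 0 = tildePi p ψ a 0 := barPi_of_lt (jIdx_spec h ha).1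

theorem barPi_last (h : IsRiskProfile p ψ) (ha : a ∈ box p ψ) :
    barPi p ψ a (n + 1) = tildePi p ψ a n :=
  barPi_of_gt (Nat.lt_succ_of_le (jIdx_spec h ha).2.1)

theorem barPi_le_succ (h : IsRiskProfile p ψ) (ha : a ∈ box p ψ) {i : ℕ} (hi : i ≤ n) :
    barPi p ψ a i ≤ barPi p ψ a (i + 1) := by
  have hj := jIdx_spec h ha
  rcases lt_trichotomy (i + 1) (jIdx p ψ a) with h1 | h1 | h1
  · rw [barPi_of_lt h1, barPi_of_lt (by omega)]
    exact tildePi_mono h ha (by omega) (by omega)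
  · rw [h1, barPi_jIdx, barPi_of_lt (by omega)]
    exact tildePi_le_half h ha (by omega)
  · rw [barPi_of_gt h1, Nat.add_sub_cancel]
    rcases (Nat.lt_succ_iff.1 h1).lt_or_eq with h2 | h2
    · rw [barPi_of_gt h2]; exact tildePi_mono h ha (by omega) hi
    · rw [← h2, barPi_jIdx]; exact hj.2.2

theorem barPi_mono (h : IsRiskProfile p ψ) (ha : a ∈ box p ψ) {i k : ℕ} (hik : i ≤ k)
    (hk : k ≤ n + 1) : barPi p ψ a i ≤ barPi p ψ a k := by
  induction k, hik using Nat.le_induction with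
  | base => exact le_rfl
  | succ m hm ih => exact (ih (by omega)).trans (barPi_le_succ h ha (by omega))

theorem barPi_nonneg (h : IsRiskProfile p ψ) (ha : a ∈ box p ψ) {i : ℕ} (hi : i ≤ n + 1) :
    0 ≤ barPi p ψ a i := by
  refine le_trans ?_ (barPi_mono h ha (Nat.zero_le i) hi)
  rw [barPi_zero h ha, ← node_zero p]
  exact node_le_tildePi h ha (Nat.zero_le n)

theorem barPi_le_one (h : IsRiskProfile p ψ) (ha : a ∈ box p ψ) {i : ℕ} (hi : i ≤ n + 1) :
    barPi p ψ a i ≤ 1 := by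
  refine le_trans (barPi_mono h ha hi le_rfl) ?_
  rw [barPi_last h ha, ← node_last p]
  exact tildePi_le_node_succ h ha le_rfl

theorem barPi_pos (h : IsRiskProfile p ψ) (ha : a ∈ box p ψ) {i : ℕ} (hi0 : 1 ≤ i)
    (hi : i ≤ n + 1) : 0 < barPi p ψ a i := by
  refine lt_of_lt_of_le ?_ (barPi_mono h ha hi0 hi)
  have hj := jIdx_spec h ha
  rcases hj.1.lt_or_eq with h1 | h1
  · rw [barPi_of_lt h1]
    have h2 := h.node_lt 0 (Nat.zero_le n)
    rw [node_zero] at h2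
    exact h2.trans_le (node_le_tildePi h ha (by omega))
  · rw [h1, barPi_jIdx]; norm_num

theorem barPi_lt_one (h : IsRiskProfile p ψ) (ha : a ∈ box p ψ) {i : ℕ} (hi : i ≤ n) :
    barPi p ψ a i < 1 := by
  refine lt_of_le_of_lt (barPi_mono h ha hi (Nat.le_succ n)) ?_
  have hj := jIdx_spec h ha
  rcases hj.2.1.lt_or_eq with h1 | h1
  · rw [barPi_of_gt h1]
    have h2 := h.node_lt n le_rfl
    rw [node_last] at h2
    have h3 := tildePi_le_node_succ h ha (k := n - 1) (by omega)
    rw [Nat.sub_add_cancel h.pos] at h3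
    exact h3.trans_lt h2
  · nth_rewrite 2 [← h1]; rw [barPi_jIdx]; norm_num

/-- On each segment the affine integrand of the objective is the gap between `min {π, 1 - π}` and
the envelope. -/
theorem segment_integrand (h : IsRiskProfile p ψ) (ha : a ∈ box p ψ) {i : ℕ} (hi : i ≤ n) {x : ℝ}
    (hx : x ∈ Ioc (barPi p ψ a i) (barPi p ψ a (i + 1))) :
    alphaCoef p ψ a (i + 1) * x + betaCoef p ψ a (i + 1)
      = min x (1 - x) - envelope p ψ a x := by
  have hj := jIdx_spec h ha
  by_cases hij : i + 1 ≤ jIdx p ψ a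
  · have hxl : tildePi p ψ a i < x := by rw [← barPi_of_lt (by omega)]; exact hx.1
    have hxh : x ≤ 1 / 2 := by
      refine hx.2.trans ?_
      rw [← barPi_jIdx (p := p) (ψ := ψ) (a := a)]
      exact barPi_mono h ha hij (by omega)
    have hxr : x ≤ tildePi p ψ a (i + 1) := by
      rcases hij.lt_or_eq with h1 | h1
      · rw [← barPi_of_lt h1]; exact hx.2
      · rw [h1]; exact hxh.trans hj.2.2
    rw [envelope_eq_line h ha (i := i + 1) (by omega)
      (fun k hk => (tildePi_mono h ha (Nat.lt_succ_iff.1 hk) hi).trans hxl.le)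
      (fun k hk hkn => hxr.trans (tildePi_mono h ha hk hkn)), alphaCoef, betaCoef, if_pos hij,
      if_pos hij, min_eq_left (by linarith)]
    ring
  · have hij' : jIdx p ψ a ≤ i := by omega
    have hxr : x ≤ tildePi p ψ a i := by
      have := hx.2; rwa [barPi_of_gt (by omega), Nat.add_sub_cancel] at this
    have hxh : 1 / 2 < x := by
      refine lt_of_le_of_lt ?_ hx.1
      rw [← barPi_jIdx (p := p) (ψ := ψ) (a := a)]
      exact barPi_mono h ha hij' (by omega)
    have hxl : tildePi p ψ a (i - 1) ≤ x := by
      rcases hij'.lt_or_eq with h1 | h1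
      · rw [← barPi_of_gt h1]; exact hx.1.le
      · exact (tildePi_le_half h ha (by omega)).trans hxh.le
    rw [envelope_eq_line h ha (i := i) (by omega)
      (fun k hk => (tildePi_mono h ha (by omega) (by omega)).trans hxl)
      (fun k hk hkn => hxr.trans (tildePi_mono h ha hk hkn)), alphaCoef, betaCoef, if_neg hij,
      if_neg hij, min_eq_right (by linarith), Nat.add_sub_cancel]
    ring

theorem segment_nonneg (h : IsRiskProfile p ψ) (ha : a ∈ box p ψ) {i : ℕ} (hi : i ≤ n) {x : ℝ}
    (hx : x ∈ Ioc (barPi p ψ a i) (barPi p ψ a (i + 1))) :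
    0 ≤ alphaCoef p ψ a (i + 1) * x + betaCoef p ψ a (i + 1) := by
  rw [segment_integrand h ha hi hx]
  exact sub_nonneg.2 (envelope_le h a x)

/-- To the left of the first kink the envelope is the line of slope `1` through `(0, 0)`. -/
theorem gap_eq_zero_of_le (h : IsRiskProfile p ψ) (ha : a ∈ box p ψ) {x : ℝ}
    (hx : x ≤ barPi p ψ a 0) : min x (1 - x) - envelope p ψ a x = 0 := by
  rw [barPi_zero h ha] at hx
  have := tildePi_zero_le_half h ha
  rw [envelope_eq_line h ha (i := 0) (by omega) (fun k hk => by omega)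
    (fun k hk hkn => hx.trans (tildePi_mono h ha hk hkn)), min_eq_left (by linarith), h.zero,
    slp_zero, node_zero]
  ring

/-- To the right of the last kink the envelope is the line of slope `-1` through `(1, 0)`. -/
theorem gap_eq_zero_of_ge (h : IsRiskProfile p ψ) (ha : a ∈ box p ψ) {x : ℝ}
    (hx : barPi p ψ a (n + 1) ≤ x) : min x (1 - x) - envelope p ψ a x = 0 := by
  rw [barPi_last h ha] at hx
  have := half_le_tildePi_last h ha
  rw [envelope_eq_line h ha (i := n + 1) le_rfl
    (fun k hk => (tildePi_mono h ha (by omega) le_rfl).trans hx) (fun k hk hkn => by omega),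
    min_eq_right (by linarith), h.last, slp_last, node_last]
  ring

theorem sum_setLIntegral_Ioc (γ : Measure ℝ) (g : ℝ → ENNReal) (b : ℕ → ℝ) (m : ℕ)
    (hb : ∀ i < m, b i ≤ b (i + 1)) :
    ∑ i ∈ Finset.range m, ∫⁻ x in Ioc (b i) (b (i + 1)), g x ∂γ
      = ∫⁻ x in Ioc (b 0) (b m), g x ∂γ := by
  have hmono : ∀ i ≤ m, b 0 ≤ b i := by
    intro i
    induction i with
    | zero => intro _; exact le_rfl
    | succ i ih => intro hi; exact (ih (by omega)).trans (hb i (by omega))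
  induction m with
  | zero => simp
  | succ m ih =>
    rw [Finset.sum_range_succ, ih (fun i hi => hb i (by omega)) (fun i hi => hmono i (by omega)),
      ← lintegral_union measurableSet_Ioc, Ioc_union_Ioc_eq_Ioc (hmono m (by omega))
        (hb m (by omega))]
    exact Ioc_disjoint_Ioc_of_le le_rfl

theorem coe_ennreal_sum {ι : Type*} (s : Finset ι) (g : ι → ENNReal) :
    ((∑ i ∈ s, g i : ENNReal) : EReal) = ∑ i ∈ s, (g i : EReal) :=
  map_sum (⟨⟨((↑) : ENNReal → EReal), rfl⟩, EReal.coe_ennreal_add⟩ : ENNReal →+ EReal) g s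

theorem eintegral_segment (h : IsRiskProfile p ψ) (ha : a ∈ box p ψ) (γ : Measure ℝ) {i : ℕ}
    (hi : i ≤ n) :
    eintegral (γ.restrict (Ioc (barPi p ψ a i) (barPi p ψ a (i + 1))))
        (fun x => alphaCoef p ψ a (i + 1) * x + betaCoef p ψ a (i + 1))
      = ((∫⁻ x in Ioc (barPi p ψ a i) (barPi p ψ a (i + 1)),
          ENNReal.ofReal (min x (1 - x) - envelope p ψ a x) ∂γ : ENNReal) : EReal) := by
  rw [eintegral_of_nonneg]
  · congr 1
    exact setLIntegral_congr_fun measurableSet_Ioc fun x hx => by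
      rw [segment_integrand h ha hi hx]
  · filter_upwards [ae_restrict_mem measurableSet_Ioc] with x hx
    exact segment_nonneg h ha hi hx

theorem objective_eq_lintegral (h : IsRiskProfile p ψ) (ha : a ∈ box p ψ) (γ : Measure ℝ) :
    objective p ψ a γ
      = ((∫⁻ x, ENNReal.ofReal (min x (1 - x) - envelope p ψ a x) ∂γ : ENNReal) : EReal) := by
  rw [objective, Finset.sum_congr rfl fun i hi =>
    eintegral_segment h ha γ (Nat.lt_succ_iff.1 (Finset.mem_range.1 hi)), ← coe_ennreal_sum,
    sum_setLIntegral_Ioc γ _ (barPi p ψ a) (n + 1)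
      (fun i hi => barPi_le_succ h ha (Nat.lt_succ_iff.1 hi))]
  congr 1
  refine setLIntegral_eq_of_support_subset ?_
  intro x hx
  by_contra hc
  refine hx ?_
  rw [mem_Ioc, not_and_or, not_lt, not_le] at hc
  rcases hc with hc | hc
  · simp only [gap_eq_zero_of_le h ha hc, ENNReal.ofReal_zero]
  · simp only [gap_eq_zero_of_ge h ha hc.le, ENNReal.ofReal_zero]

end Envelope

/-! ### The objective in terms of iterated primitives -/

section Primitives

variable {γ : Measure ℝ} {G Gbar : ℝ → ℝ}

theorem IsIteratedPrimitive.monotoneOn (hG : IsIteratedPrimitive γ G Gbar) :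
    MonotoneOn G (Ioo 0 1) := by
  intro u hu v hv huv
  have := hG.sub_eq u v hu.1 huv hv.2
  have h2 : 0 ≤ (γ (Ioc u v)).toReal := ENNReal.toReal_nonneg
  linarith

/-- Integration by parts on `(u, v]`. -/
theorem IsIteratedPrimitive.sub_eq_setIntegral [SFinite γ] (hG : IsIteratedPrimitive γ G Gbar)
    (hfin : ∀ u v, 0 < u → v < 1 → γ (Ioc u v) < ⊤) {u v : ℝ} (hu : 0 < u) (huv : u ≤ v)
    (hv : v < 1) (α β : ℝ) :
    ((α * v + β) * G v - α * Gbar v) - ((α * u + β) * G u - α * Gbar u)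
      = ∫ x in Ioc u v, (α * x + β) ∂γ := by
  have hsub : uIcc u v ⊆ Ioo 0 1 := by
    rw [uIcc_of_le huv]
    exact fun x hx => ⟨hu.trans_le hx.1, hx.2.trans_lt hv⟩
  have hGi : IntervalIntegrable G volume u v := (hG.monotoneOn.mono hsub).intervalIntegrable
  have hfin' : IsFiniteMeasure (γ.restrict (Ioc u v)) := ⟨by simpa using hfin u v hu hv⟩
  have hid : IntegrableOn (fun x => x - u) (Ioc u v) γ := by
    refine Integrable.of_bound (C := v - u) (by fun_prop) ?_
    filter_upwards [ae_restrict_mem measurableSet_Ioc] with x hx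
    rw [Real.norm_eq_abs, abs_of_pos (sub_pos.2 hx.1)]
    linarith [hx.2]
  have h1 : ∫ x in Ioc u v, (x - u) ∂γ = ∫ t in u..v, (G v - G t) := by
    rw [intervalIntegral.integral_of_le huv, integral_eq_lintegral_of_nonneg_ae,
      integral_eq_lintegral_of_nonneg_ae, lintegral_Ioc_sub_left]
    · congr 1
      refine setLIntegral_congr_fun measurableSet_Ioc fun t ht => ?_
      rw [hG.sub_eq t v (hu.trans ht.1) ht.2 hv,
        ENNReal.ofReal_toReal (hfin t v (hu.trans ht.1) hv).ne]
    · filter_upwards [ae_restrict_mem measurableSet_Ioc] with t ht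
      exact (hG.sub_eq t v (hu.trans ht.1) ht.2 hv).symm ▸ ENNReal.toReal_nonneg
    · exact (integrable_const (G v)).aestronglyMeasurable.sub hGi.1.aestronglyMeasurable
    · filter_upwards [ae_restrict_mem measurableSet_Ioc] with t ht
      exact sub_nonneg.2 ht.1.le
    · fun_prop
  have h2 : ∫ x in Ioc u v, (α * x + β) ∂γ
      = α * (∫ x in Ioc u v, (x - u) ∂γ) + (α * u + β) * (γ (Ioc u v)).toReal := by
    rw [← integral_const_mul, show (α * u + β) * (γ (Ioc u v)).toReal
        = ∫ x in Ioc u v, (α * u + β) ∂γ by rw [setIntegral_const, smul_eq_mul, mul_comm]; rfl,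
      ← integral_add (hid.const_mul α) (integrable_const _)]
    congr 1; ext x; ring
  rw [h2, h1, intervalIntegral.integral_sub (by simp) hGi, ← hG.bar_sub_eq u v hu huv hv,
    ← hG.sub_eq u v hu huv hv, intervalIntegral.integral_const, smul_eq_mul]
  ring

/-- The integral of an affine function over a segment `(u, v]` of `[0, 1]` on which it is
nonnegative, by its antiderivative. Because of the sign, the antiderivative is monotone on the
segment, so it has a limit in the extended reals at a singular end point. At most one end point is
singular, so that no difference `∞ - ∞` arises. -/
theorem IsIteratedPrimitive.boundaryTerm_sub [SFinite γ] (hG : IsIteratedPrimitive γ G Gbar)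
    (hfin : ∀ u v, 0 < u → v < 1 → γ (Ioc u v) < ⊤) (hsupp : ∀ᵐ x ∂γ, x ∈ Ioo (0 : ℝ) 1)
    {u v : ℝ} (hu : 0 ≤ u) (hu1 : u < 1) (huv : u ≤ v) (hv0 : 0 < v) (hv : v ≤ 1)
    (huv' : 0 < u ∨ v < 1) {α β : ℝ} (hnn : ∀ x ∈ Ioc u v, 0 ≤ α * x + β) :
    boundaryTerm G Gbar α β v - boundaryTerm G Gbar α β u
      = ((∫⁻ x in Ioc u v, ENNReal.ofReal (α * x + β) ∂γ : ENNReal) : EReal) := by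
  set Φ : ℝ → ℝ := fun t => (α * t + β) * G t - α * Gbar t with hΦ
  have hmeas : Measurable fun x : ℝ => ENNReal.ofReal (α * x + β) := by fun_prop
  have key : ∀ s t, 0 < s → s ≤ t → t < 1 → u ≤ s → t ≤ v →
      ∫⁻ x in Ioc s t, ENNReal.ofReal (α * x + β) ∂γ = ENNReal.ofReal (Φ t - Φ s) ∧
        0 ≤ Φ t - Φ s := by
    intro s t hs hst ht hus htv
    have hfin' : IsFiniteMeasure (γ.restrict (Ioc s t)) := ⟨by simpa using hfin s t hs ht⟩
    have hint : IntegrableOn (fun x => α * x + β) (Ioc s t) γ := by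
      refine Integrable.of_bound (C := |α| + |β|) (by fun_prop) ?_
      filter_upwards [ae_restrict_mem measurableSet_Ioc] with x hx
      have hx1 : |x| ≤ 1 := abs_le.2 ⟨by linarith [hx.1], by linarith [hx.2]⟩
      calc ‖α * x + β‖ ≤ |α * x| + |β| := norm_add_le _ _
        _ ≤ |α| + |β| := by
          rw [abs_mul]
          have := mul_le_mul_of_nonneg_left hx1 (abs_nonneg α)
          linarith
    have h0 : 0 ≤ᵐ[γ.restrict (Ioc s t)] fun x => α * x + β := by
      filter_upwards [ae_restrict_mem measurableSet_Ioc] with x hx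
      exact hnn x ⟨hus.trans_lt hx.1, hx.2.trans htv⟩
    have h1 := hG.sub_eq_setIntegral hfin hs hst ht α β
    rw [← ofReal_integral_eq_lintegral_ofReal hint h0]
    simp only [hΦ]
    rw [h1]
    exact ⟨rfl, integral_nonneg_of_ae h0⟩
  have key' : ∀ s t, 0 < s → s ≤ t → t < 1 → u ≤ s → t ≤ v →
      ((∫⁻ x in Ioc s t, ENNReal.ofReal (α * x + β) ∂γ : ENNReal) : EReal)
        = ((Φ t - Φ s : ℝ) : EReal) := by
    intro s t hs hst ht hus htv
    obtain ⟨h1, h2⟩ := key s t hs hst ht hus htv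
    rw [h1, EReal.coe_ennreal_ofReal, max_eq_left h2]
  rcases hu.eq_or_lt with rfl | hu0
  -- the left end point is singular
  · have hv1 : v < 1 := huv'.resolve_left (lt_irrefl _)
    set I := ∫⁻ x in Ioc 0 v, ENNReal.ofReal (α * x + β) ∂γ with hI
    have hlimI : Tendsto (fun t => ∫⁻ x in Ioc t v, ENNReal.ofReal (α * x + β) ∂γ)
        (𝓝[Ioo (0 : ℝ) 1] 0) (𝓝 I) := by
      simp_rw [hI, ← lintegral_indicator measurableSet_Ioc]
      refine tendsto_lintegral_of_le (fun t => hmeas.indicator measurableSet_Ioc) ?_ ?_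
      · filter_upwards [hsupp] with x hx
        refine tendsto_const_nhds.congr' ?_
        filter_upwards [nhdsWithin_le_nhds (Iio_mem_nhds hx.1)] with t ht
        have ht' : t < x := ht
        simp only [indicator, mem_Ioc, hx.1, ht', true_and]
      · filter_upwards [self_mem_nhdsWithin] with t ht
        exact Eventually.of_forall fun x => indicator_le_indicator_of_subset
          (Ioc_subset_Ioc_left (le_of_lt ht.1)) (fun _ => zero_le) x
    have hlim : Tendsto (fun t : ℝ => ((Φ t : ℝ) : EReal)) (𝓝[Ioo (0 : ℝ) 1] 0)
        (𝓝 (-(I : EReal) + ((Φ v : ℝ) : EReal))) := by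
      have h1 : Tendsto (fun t => -((∫⁻ x in Ioc t v, ENNReal.ofReal (α * x + β) ∂γ : ENNReal)
          : EReal)) (𝓝[Ioo (0 : ℝ) 1] 0) (𝓝 (-(I : EReal))) :=
        (continuous_neg.tendsto _).comp ((continuous_coe_ennreal_ereal.tendsto I).comp hlimI)
      have h2 := (EReal.continuousAt_add (p := (-(I : EReal), ((Φ v : ℝ) : EReal)))
        (Or.inr (by simp)) (Or.inr (by simp))).tendsto.comp
          (h1.prodMk_nhds (tendsto_const_nhds (x := ((Φ v : ℝ) : EReal))))
      refine h2.congr' ?_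
      filter_upwards [self_mem_nhdsWithin, nhdsWithin_le_nhds (Iio_mem_nhds hv0)] with t ht ht'
      have h3 := key' t v ht.1 (le_of_lt ht') hv1 (le_of_lt ht.1) le_rfl
      simp only [Function.comp]
      rw [h3, ← EReal.coe_neg, ← EReal.coe_add]
      congr 1; ring
    have hne : (𝓝[Ioo (0 : ℝ) 1] 0).NeBot := left_nhdsWithin_Ioo_neBot one_pos
    rw [boundaryTerm, if_pos ⟨hv0, hv1⟩, boundaryTerm, if_neg (fun h => lt_irrefl _ h.1)]
    have h4 := hlim.limUnder_eq
    simp only [hΦ] at h4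
    rw [h4]
    induction I with
    | top =>
      rw [EReal.coe_ennreal_top, EReal.neg_top, EReal.bot_add]
      exact EReal.sub_bot (EReal.coe_ne_bot _)
    | coe r =>
      rw [show ((r : ENNReal) : EReal) = (((r : ℝ)) : EReal) from rfl, ← EReal.coe_neg,
        ← EReal.coe_add, ← EReal.coe_sub]
      congr 1; ring
  · rcases hv.lt_or_eq with hv1 | rfl
    · rw [boundaryTerm, if_pos ⟨hv0, hv1⟩, boundaryTerm, if_pos ⟨hu0, hu1⟩,
        key' u v hu0 huv hv1 le_rfl le_rfl, ← EReal.coe_sub]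
    -- the right end point is singular
    · set I := ∫⁻ x in Ioc u 1, ENNReal.ofReal (α * x + β) ∂γ with hI
      have hlimI : Tendsto (fun t => ∫⁻ x in Ioc u t, ENNReal.ofReal (α * x + β) ∂γ)
          (𝓝[Ioo (0 : ℝ) 1] 1) (𝓝 I) := by
        simp_rw [hI, ← lintegral_indicator measurableSet_Ioc]
        refine tendsto_lintegral_of_le (fun t => hmeas.indicator measurableSet_Ioc) ?_ ?_
        · filter_upwards [hsupp] with x hx
          refine tendsto_const_nhds.congr' ?_
          filter_upwards [nhdsWithin_le_nhds (Ioi_mem_nhds hx.2)] with t ht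
          have ht' : x ≤ t := le_of_lt ht
          simp only [indicator, mem_Ioc, hx.2.le, ht', and_true]
        · filter_upwards [self_mem_nhdsWithin] with t ht
          exact Eventually.of_forall fun x => indicator_le_indicator_of_subset
            (Ioc_subset_Ioc_right (le_of_lt ht.2)) (fun _ => zero_le) x
      have hlim : Tendsto (fun t : ℝ => ((Φ t : ℝ) : EReal)) (𝓝[Ioo (0 : ℝ) 1] 1)
          (𝓝 ((I : EReal) + ((Φ u : ℝ) : EReal))) := by
        refine (tendsto_coe_ennreal_add hlimI (tendsto_const_nhds (x := Φ u))).congr' ?_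
        filter_upwards [self_mem_nhdsWithin, nhdsWithin_le_nhds (Ioi_mem_nhds hu1)] with t ht ht'
        rw [key' u t hu0 (le_of_lt ht') ht.2 le_rfl (le_of_lt ht.2), ← EReal.coe_add]
        congr 1; ring
      have hne : (𝓝[Ioo (0 : ℝ) 1] 1).NeBot := right_nhdsWithin_Ioo_neBot one_pos
      rw [boundaryTerm, if_neg (fun h => lt_irrefl _ h.2), boundaryTerm, if_pos ⟨hu0, hu1⟩]
      have h4 := hlim.limUnder_eq
      simp only [hΦ] at h4
      rw [h4]
      exact EReal.add_sub_cancel_right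

theorem objectiveEval_eq_objective [SFinite γ] {n : ℕ} {p : Fin n → ℝ} {ψ : ℕ → ℝ}
    {a : Fin n → ℝ} (h : IsRiskProfile p ψ) (ha : a ∈ box p ψ)
    (hG : IsIteratedPrimitive γ G Gbar) (hfin : ∀ u v, 0 < u → v < 1 → γ (Ioc u v) < ⊤)
    (hsupp : ∀ᵐ x ∂γ, x ∈ Ioo (0 : ℝ) 1) :
    objectiveEval p ψ a G Gbar = objective p ψ a γ := by
  rw [objectiveEval, objective]
  refine Finset.sum_congr rfl fun i hi => ?_
  have hin : i ≤ n := Nat.lt_succ_iff.1 (Finset.mem_range.1 hi)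
  have hends : 0 < barPi p ψ a i ∨ barPi p ψ a (i + 1) < 1 := by
    rcases Nat.eq_zero_or_pos i with rfl | hi0
    · exact Or.inr (barPi_lt_one h ha h.pos)
    · exact Or.inl (barPi_pos h ha hi0 (by omega))
  rw [hG.boundaryTerm_sub hfin hsupp (barPi_nonneg h ha (by omega)) (barPi_lt_one h ha hin)
    (barPi_le_succ h ha hin) (barPi_pos h ha (by omega) (by omega))
    (barPi_le_one h ha (by omega)) hends (fun x hx => segment_nonneg h ha hin hx),
    eintegral_of_nonneg]
  filter_upwards [ae_restrict_mem measurableSet_Ioc] with x hx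
  exact segment_nonneg h ha hin hx

end Primitives

/-! ### Attainment of the minimum -/

section Minimum

variable {n : ℕ} {p : Fin n → ℝ} {ψ : ℕ → ℝ}

theorem isCompact_box (h : IsRiskProfile p ψ) : IsCompact (box p ψ) := by
  refine IsCompact.of_isClosed_subset (isCompact_Icc (a := fun _ : Fin n => (-1 : ℝ))
    (b := fun _ => 1)) ?_ ?_
  · have hs : ∀ k, Continuous fun a : Fin n → ℝ => slp a k := by
      intro k
      unfold slp pad
      split_ifs <;> fun_prop
    have : box p ψ = ⋂ i ∈ Finset.Icc 1 n,
        {a | (ψ (i + 1) - ψ i) / (node p (i + 1) - node p i) ≤ slp a i ∧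
          slp a i ≤ (ψ i - ψ (i - 1)) / (node p i - node p (i - 1))} := by
      ext a; simp [box]
    rw [this]
    exact isClosed_biInter fun i _ => (isClosed_le continuous_const (hs i)).inter
      (isClosed_le (hs i) continuous_const)
  · intro a ha
    have hb : ∀ i : Fin n, a i ∈ Icc (-1 : ℝ) 1 := by
      intro i
      rw [← pad_succ 1 (-1) a i]
      exact slp_mem_Icc h ha (by omega)
    exact ⟨fun i => (hb i).1, fun i => (hb i).2⟩

/-- By Fatou's lemma the objective is lower semicontinuous, so it attains its minimum over the
compact box. -/
theorem exists_min_gap (h : IsRiskProfile p ψ) (hne : (box p ψ).Nonempty) (γ : Measure ℝ) :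
    ∃ a₀ ∈ box p ψ, IsMinOn (fun a => ∫⁻ x, ENNReal.ofReal (min x (1 - x) - envelope p ψ a x) ∂γ)
      (box p ψ) a₀ := by
  refine LowerSemicontinuousOn.exists_isMinOn hne (isCompact_box h) ?_
  refine LowerSemicontinuous.lowerSemicontinuousOn ?_ _
  rw [lowerSemicontinuous_iff_le_liminf]
  intro a
  refine le_trans (le_of_eq ?_) (lintegral_liminf_le fun b => ?_)
  · congr 1
    ext x
    refine (Tendsto.liminf_eq ?_).symm
    exact (ENNReal.continuous_ofReal.comp
      (continuous_const.sub (continuous_envelope_slopes p ψ x))).tendsto a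
  · have := continuous_envelope p ψ b
    fun_prop

end Minimum

/-! ### The Bayes risk as a concave function -/

section Risk

variable {X : Type*} [MeasurableSpace X] (P Q : Measure X)

theorem bayesRisk_zero : bayesRisk P Q 0 = 0 := by simp [bayesRisk]

theorem bayesRisk_one : bayesRisk P Q 1 = 0 := by simp [bayesRisk, lratio_nonneg]

variable [IsProbabilityMeasure P] [IsProbabilityMeasure Q]

theorem bayesRisk_le_right (π : ℝ) : bayesRisk P Q π ≤ 1 - π := by
  have := integral_mono (integrable_min_lratio P Q (1 - π) π) (integrable_const (1 - π))
    (fun x => min_le_left _ _)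
  simpa [bayesRisk] using this

theorem bayesRisk_le_left {π : ℝ} (hπ : 0 ≤ π) : bayesRisk P Q π ≤ π := by
  have h1 := integral_mono (integrable_min_lratio P Q (1 - π) π)
    ((integrable_lratio P Q).const_mul π) (fun x => min_le_right _ _)
  rw [integral_const_mul] at h1
  have h2 := integral_lratio_add_singularPart P Q
  have h3 : 0 ≤ (P.singularPart Q univ).toReal := ENNReal.toReal_nonneg
  have h4 := mul_le_mul_of_nonneg_left (by linarith : ∫ x, lratio P Q x ∂Q ≤ 1) hπ
  unfold bayesRisk; linarith

/-- The risk of the test that is optimal for the prior `π` is affine in the prior, and is an upper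
bound for the Bayes risk: a supporting line at `π`. -/
theorem exists_supporting_line (π : ℝ) :
    ∃ c, ∀ π', bayesRisk P Q π' ≤ bayesRisk P Q π + c * (π' - π) := by
  classical
  set A : Set X := {x | 1 - π ≤ π * lratio P Q x} with hA
  have hAm : MeasurableSet A :=
    measurableSet_le measurable_const ((measurable_lratio P Q).const_mul π)
  set g : X → ℝ := A.piecewise (fun _ => -1) (lratio P Q) with hg
  have hgi : Integrable g Q :=
    Integrable.piecewise hAm (integrable_const _).integrableOn (integrable_lratio P Q).integrableOn
  refine ⟨∫ x, g x ∂Q, fun π' => ?_⟩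
  rw [bayesRisk, bayesRisk, ← integral_mul_const,
    ← integral_add (integrable_min_lratio P Q _ _) (hgi.mul_const _)]
  refine integral_mono (integrable_min_lratio P Q _ _)
    ((integrable_min_lratio P Q _ _).add (hgi.mul_const _)) fun x => ?_
  simp only []
  by_cases hx : x ∈ A
  · have hx' : 1 - π ≤ π * lratio P Q x := hx
    rw [hg, piecewise_eq_of_mem _ _ _ hx, min_eq_left hx']
    linarith [min_le_left (1 - π') (π' * lratio P Q x)]
  · have hx' : π * lratio P Q x < 1 - π := not_le.1 hx
    rw [hg, piecewise_eq_of_notMem _ _ _ hx, min_eq_right hx'.le]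
    linarith [min_le_right (1 - π') (π' * lratio P Q x)]

variable {n : ℕ} {p : Fin n → ℝ}

theorem node_mem_Icc (hp01 : ∀ i, p i ∈ Ioo (0 : ℝ) 1) (i : ℕ) : node p i ∈ Icc (0 : ℝ) 1 := by
  rw [node, pad]
  split_ifs with h1 h2
  · simp
  · exact Ioo_subset_Icc_self (hp01 _)
  · simp

theorem psi_eq_bayesRisk (hp01 : ∀ i, p i ∈ Ioo (0 : ℝ) 1) (i : ℕ) :
    psi P Q p i = bayesRisk P Q (node p i) := by
  rw [psi, genVar_eq P Q (node_mem_Icc hp01 i), min_comm]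
  ring

theorem isRiskProfile_psi (hn : 0 < n) (hp : StrictMono p) (hp01 : ∀ i, p i ∈ Ioo (0 : ℝ) 1) :
    IsRiskProfile p (psi P Q p) where
  pos := hn
  node_lt k hk := node_lt_node_succ hp hp01 hk
  zero := by rw [psi_eq_bayesRisk P Q hp01, node_zero, bayesRisk_zero]
  last := by rw [psi_eq_bayesRisk P Q hp01, node_last, bayesRisk_one]
  le_left k _ := by
    rw [psi_eq_bayesRisk P Q hp01]; exact bayesRisk_le_left P Q (node_mem_Icc hp01 k).1
  le_right k _ := by rw [psi_eq_bayesRisk P Q hp01]; exact bayesRisk_le_right P Q _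

/-- The slopes of supporting lines of the Bayes risk at the nodes are admissible, and the envelope
that they define is an upper bound for the Bayes risk. -/
theorem exists_mem_box_bayesRisk_le (hn : 0 < n) (hp : StrictMono p)
    (hp01 : ∀ i, p i ∈ Ioo (0 : ℝ) 1) :
    ∃ a ∈ box p (psi P Q p), ∀ x, 0 ≤ x → bayesRisk P Q x ≤ envelope p (psi P Q p) a x := by
  have h := isRiskProfile_psi P Q hn hp hp01
  choose c hc using exists_supporting_line P Q
  set a : Fin n → ℝ := fun i => c (p i) with ha_def
  have hslp : ∀ i, 1 ≤ i → i ≤ n → slp a i = c (node p i) := by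
    intro i hi hin
    obtain ⟨m, rfl⟩ : ∃ m, i = m + 1 := ⟨i - 1, by omega⟩
    have h1 : slp a (m + 1) = a ⟨m, hin⟩ := pad_succ 1 (-1) a ⟨m, hin⟩
    have h2 : node p (m + 1) = p ⟨m, hin⟩ := pad_succ 0 1 p ⟨m, hin⟩
    rw [h1, h2]
  have ha : a ∈ box p (psi P Q p) := by
    rw [mem_box_iff h]
    intro i hi hin
    simp only [psi_eq_bayesRisk P Q hp01, hslp i hi hin]
    have h1 := hc (node p i) (node p (i + 1))
    have h2 := hc (node p i) (node p (i - 1))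
    constructor <;> linarith
  refine ⟨a, ha, fun x hx => ?_⟩
  obtain ⟨i, hi, heq⟩ := exists_envelope_eq_line h ha x
  rw [heq]
  rcases Nat.eq_zero_or_pos i with rfl | hi0
  · rw [h.zero, slp_zero, node_zero]
    linarith [bayesRisk_le_left P Q hx]
  · rcases hi.lt_or_eq with hin | rfl
    · rw [hslp i hi0 (by omega), psi_eq_bayesRisk P Q hp01]
      exact hc _ _
    · rw [h.last, slp_last, node_last]
      linarith [bayesRisk_le_right P Q x]

end Risk

/-! ### Discrete measures with a prescribed Bayes risk -/

section Discrete

variable {X : Type*} [MeasurableSpace X]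

/-- The measure with mass `c k` at the point `e k`, for `k < m`. -/
def atomic (e : ℕ → X) (m : ℕ) (c : ℕ → ℝ) : Measure X :=
  ∑ k ∈ Finset.range m, ENNReal.ofReal (c k) • Measure.dirac (e k)

variable {e : ℕ → X} {m : ℕ} {c d : ℕ → ℝ}

theorem isProbabilityMeasure_atomic (hc : ∀ k < m, 0 ≤ c k)
    (hsum : ∑ k ∈ Finset.range m, c k = 1) : IsProbabilityMeasure (atomic e m c) := by
  refine ⟨?_⟩
  simp only [atomic, Measure.coe_finsetSum, Finset.sum_apply, Measure.smul_apply, measure_univ,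
    smul_eq_mul, mul_one]
  rw [← ENNReal.ofReal_sum_of_nonneg fun k hk => hc k (Finset.mem_range.1 hk), hsum,
    ENNReal.ofReal_one]

variable [MeasurableSingletonClass X]

/-- At an atom of `Q` the likelihood ratio is the ratio of the masses. -/
theorem lratio_mul_singleton (P Q : Measure X) [IsFiniteMeasure P] [IsFiniteMeasure Q] {x : X}
    (hx : Q {x} ≠ 0) : lratio P Q x * (Q {x}).toReal = (P {x}).toReal := by
  have hs : P.singularPart Q {x} = 0 := by
    obtain ⟨s, -, h1, h2⟩ := Measure.mutuallySingular_singularPart P Q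
    by_cases hxs : x ∈ s
    · exact measure_mono_null (singleton_subset_iff.2 hxs) h1
    · exact absurd (measure_mono_null (singleton_subset_iff.2 hxs) h2) hx
  have h1 : P {x} = P.rnDeriv Q x * Q {x} := by
    conv_lhs => rw [← Measure.singularPart_add_rnDeriv P Q]
    rw [Measure.add_apply, hs, zero_add, withDensity_apply _ (measurableSet_singleton x),
      lintegral_singleton]
  rw [h1, ENNReal.toReal_mul, lratio]

theorem atomic_singleton (he : Function.Injective e) {k : ℕ} (hk : k < m) :
    atomic e m c {e k} = ENNReal.ofReal (c k) := by
  simp only [atomic, Measure.coe_finsetSum, Finset.sum_apply, Measure.smul_apply, smul_eq_mul,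
    Measure.dirac_apply]
  rw [Finset.sum_eq_single_of_mem k (Finset.mem_range.2 hk)]
  · simp
  · intro l _ hl
    simp [he.ne hl]

theorem integral_atomic (hc : ∀ k < m, 0 ≤ c k) (g : X → ℝ) :
    ∫ x, g x ∂(atomic e m c) = ∑ k ∈ Finset.range m, c k * g (e k) := by
  rw [atomic, integral_finsetSum_measure]
  · refine Finset.sum_congr rfl fun k hk => ?_
    rw [integral_smul_measure, integral_dirac, ENNReal.toReal_ofReal
      (hc k (Finset.mem_range.1 hk)), smul_eq_mul]
  · intro k _
    exact (integrable_dirac (by simp)).smul_measure ENNReal.ofReal_ne_top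

theorem bayesRisk_atomic (he : Function.Injective e) (hc : ∀ k < m, 0 ≤ c k)
    (hd : ∀ k < m, 0 ≤ d k) (hcs : ∑ k ∈ Finset.range m, c k = 1)
    (hds : ∑ k ∈ Finset.range m, d k = 1) {π : ℝ} (hπ : 0 ≤ π) :
    bayesRisk (atomic e m c) (atomic e m d) π
      = ∑ k ∈ Finset.range m, min ((1 - π) * d k) (π * c k) := by
  have := isProbabilityMeasure_atomic (e := e) hc hcs
  have := isProbabilityMeasure_atomic (e := e) hd hds
  rw [bayesRisk, integral_atomic hd]
  refine Finset.sum_congr rfl fun k hk => ?_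
  have hk' := Finset.mem_range.1 hk
  rcases (hd k hk').eq_or_lt with h0 | h0
  -- an atom of the first measure only: the minimum is `0`
  · rw [← h0, zero_mul, mul_zero, min_eq_left (mul_nonneg hπ (hc k hk'))]
  · have h1 : atomic e m d {e k} ≠ 0 := by
      rw [atomic_singleton he hk']; exact (ENNReal.ofReal_pos.2 h0).ne'
    have h2 := lratio_mul_singleton (atomic e m c) (atomic e m d) h1
    rw [atomic_singleton he hk', atomic_singleton he hk', ENNReal.toReal_ofReal h0.le,
      ENNReal.toReal_ofReal (hc k hk')] at h2
    rw [mul_min_of_nonneg _ _ h0.le, ← h2]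
    congr 1 <;> ring

/-- The envelope is the Bayes risk of two discrete measures: the atom `k` carries the total mass
`a_k - a_{k+1}`, of which the second measure takes the fraction `π̃_k`. -/
theorem exists_bayesRisk_eq_envelope {n : ℕ} {p : Fin n → ℝ} {ψ : ℕ → ℝ} {a : Fin n → ℝ}
    (h : IsRiskProfile p ψ) (ha : a ∈ box p ψ) (he : Function.Injective e) :
    ∃ P Q : Measure X, IsProbabilityMeasure P ∧ IsProbabilityMeasure Q ∧
      ∀ x, 0 ≤ x → bayesRisk P Q x = envelope p ψ a x := by
  set d : ℕ → ℝ := fun k =>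
    ψ (k + 1) - ψ k + slp a k * node p k - slp a (k + 1) * node p (k + 1) with hd_def
  set w : ℕ → ℝ := fun k => slp a k - slp a (k + 1) with hw_def
  have hw : ∀ k < n + 1, 0 ≤ w k := fun k hk => sub_nonneg.2 (slp_succ_le h ha (by omega))
  have hdw : ∀ k < n + 1, d k = w k * tildePi p ψ a k := fun k hk =>
    (mul_tildePi h ha (by omega)).symm
  have hd : ∀ k < n + 1, 0 ≤ d k := fun k hk => by
    rw [hdw k hk]
    exact mul_nonneg (hw k hk)
      ((h.node_nonneg (by omega)).trans (node_le_tildePi h ha (by omega)))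
  have hc : ∀ k < n + 1, 0 ≤ w k - d k := fun k hk => by
    rw [hdw k hk]
    have h1 : tildePi p ψ a k ≤ 1 :=
      (tildePi_le_node_succ h ha (by omega)).trans (h.node_le_one (by omega))
    nlinarith [hw k hk]
  have hds : ∑ k ∈ Finset.range (n + 1), d k = 1 := by
    rw [hd_def, sum_kink_fst, h.zero, h.last, node_zero, slp_last, node_last]; ring
  have hcs : ∑ k ∈ Finset.range (n + 1), (w k - d k) = 1 := by
    rw [Finset.sum_sub_distrib, hds, hw_def, sum_kink_weight, slp_zero, slp_last]; ring
  refine ⟨atomic e (n + 1) fun k => w k - d k, atomic e (n + 1) d,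
    isProbabilityMeasure_atomic hc hcs, isProbabilityMeasure_atomic hd hds, fun x hx => ?_⟩
  rw [bayesRisk_atomic he hc hd hcs hds hx, envelope]
  have h1 : ∀ k, min ((1 - x) * d k) (x * (w k - d k)) = min (d k) (w k * x) - x * d k := by
    intro k
    rw [← min_sub_sub_right]
    congr 1 <;> ring
  simp_rw [h1]
  rw [Finset.sum_sub_distrib, ← Finset.mul_sum, hds, mul_one]

end Discrete

end

end GenPinsker

open GenPinsker
theorem theorem2 {X : Type*} [MeasurableSpace X]
    (P Q : Measure X) [IsProbabilityMeasure P] [IsProbabilityMeasure Q]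
    (f : ℝ → ℝ) (hf : ConvexOn ℝ (Ioi 0) f) (hf1 : f 1 = 0)
    (n : ℕ) (hn : 0 < n) (p : Fin n → ℝ) (hp : StrictMono p) (hp01 : ∀ i, p i ∈ Ioo (0 : ℝ) 1) :
    ∃ m : EReal,
      IsLeast ((fun a => objective p (psi P Q p) a (weight hf)) '' box p (psi P Q p)) m ∧
      (∀ G Gbar : ℝ → ℝ, IsIteratedPrimitive (weight hf) G Gbar →
        (∀ a ∈ box p (psi P Q p), objectiveEval p (psi P Q p) a G Gbar
          = objective p (psi P Q p) a (weight hf)) ∧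
        IsLeast ((fun a => objectiveEval p (psi P Q p) a G Gbar) '' box p (psi P Q p)) m) ∧
      m ≤ fDiv f P Q ∧
      (∀ [TopologicalSpace X] [T1Space X] [OpensMeasurableSpace X],
        (∃ x : X, (connectedComponent x).Nontrivial) →
        ∃ P' Q' : Measure X, IsProbabilityMeasure P' ∧ IsProbabilityMeasure Q' ∧
          (∀ i, genVar (p i) P' Q' = genVar (p i) P Q) ∧
          fDiv f P' Q' = m) := by
  have h := isRiskProfile_psi P Q hn hp hp01
  have hsupp := ae_weight_mem_Ioo hf
  obtain ⟨a₁, ha₁, hle⟩ := exists_mem_box_bayesRisk_le P Q hn hp hp01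
  obtain ⟨a₀, ha₀, hmin⟩ := exists_min_gap h ⟨a₁, ha₁⟩ (weight hf)
  have hobj := fun a (ha : a ∈ box p (psi P Q p)) => objective_eq_lintegral h ha (weight hf)
  have hleast : IsLeast ((fun a => objective p (psi P Q p) a (weight hf)) '' box p (psi P Q p))
      (objective p (psi P Q p) a₀ (weight hf)) := by
    refine ⟨mem_image_of_mem _ ha₀, ?_⟩
    rintro _ ⟨a, ha, rfl⟩
    simp only [hobj a ha, hobj a₀ ha₀, EReal.coe_ennreal_le_coe_ennreal_iff]
    exact hmin ha
  refine ⟨_, hleast, fun G Gbar hG => ?_, ?_, ?_⟩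
  · have heval := fun a (ha : a ∈ box p (psi P Q p)) =>
      objectiveEval_eq_objective h ha hG (fun u v hu hv => weight_Ioc_lt_top hf hu hv) hsupp
    exact ⟨heval, by rwa [image_congr heval]⟩
  · refine (hleast.2 (mem_image_of_mem _ ha₁)).trans ?_
    rw [hobj a₁ ha₁, fDiv_eq_lintegral P Q hf hf1, EReal.coe_ennreal_le_coe_ennreal_iff]
    refine lintegral_mono_ae ?_
    filter_upwards [hsupp] with x hx
    exact ENNReal.ofReal_le_ofReal (sub_le_sub_left (hle x hx.1.le) _)
  · intro _ _ _ hx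
    obtain ⟨x, hx⟩ := hx
    have hinf : (connectedComponent x).Infinite :=
      isPreconnected_connectedComponent.infinite_of_nontrivial hx
    have : Infinite X := Set.infinite_univ_iff.1 (hinf.mono (subset_univ _))
    obtain ⟨P', Q', hP', hQ', heq⟩ := exists_bayesRisk_eq_envelope h ha₀
      (Infinite.natEmbedding X).injective
    refine ⟨P', Q', hP', hQ', fun i => ?_, ?_⟩
    · have hi := Ioo_subset_Icc_self (hp01 i)
      have hnode : node p (i + 1) = p i := pad_succ 0 1 p i
      rw [genVar_eq P' Q' hi, genVar_eq P Q hi, heq _ hi.1, ← hnode,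
        envelope_node h ha₀ (by omega), psi_eq_bayesRisk P Q hp01]
    · rw [fDiv_eq_lintegral P' Q' hf hf1, hobj a₀ ha₀]
      congr 1
      refine lintegral_congr_ae ?_
      filter_upwards [hsupp] with y hy
      rw [heq y hy.1.le]
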